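/- All graphs are finite and simple. Let $G$ be a graph of order $n$. For a vertex $u$ let $d_G(u)$ be its degree, and for a set $I$ of vertices let $w_G(I)=\sum_{u\in I}d_G(u)$. An independent set $I\neq\emptyset$ of $G$ is *large* if $|I|\ge \min_{u\in I} d_G(u)+1$; an independent set $I$ is *light* if $w_G(I)\le n-1$. Let $\sigma^*(G)$ be the minimum of $w_G(I)$ over all large independent sets $I$ of $G$, with $\sigma^*(G)=+\infty$ if there are none, and let $\alpha^*(G)$ be the maximum size of a light independent set of $G$. A graph is $2$-connected if it has more than $2$ vertices and remains connected after the deletion of any set of fewer than $2$ vertices. A *2-proper partition* of $G$ is a partition $\mathcal P$ of $V(G)$ such that every part induces a $2$-connected subgraph of $G$. **Theorem.** If $\sigma^*(G)\ge n$, then $G$ has a 2-proper partition $\mathcal P$ with $|\mathcal P|\le\alpha^*(G)$, or $G$ is isomorphic to a graph in $\{K_2,F_5\}\cup\mathcal F_{11}\cup\mathcal F_{12}\cup\mathcal H_n$. Here: - $K_2$ is the complete graph on two vertices. - $F_5$ has vertices $a,b_1,\dots,b_4$ and edges $ab_i$ $(1\le i\le 4)$, $b_1b_2$, $b_3b_4$.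 - $\mathcal F_{11}$ consists of the graphs with vertices $a,b_1,b_2,c_1,\dots,c_8$ and edge set $\{ac_i\mid 1\le i\le 8\}\cup\{b_1c_i\mid 1\le i\le 4\}\cup\{b_2c_i\mid 5\le i\le 8\}\cup\{c_1c_2,c_3c_4,c_5c_6,c_7c_8\}\cup L$ with $L\subseteq\{ab_1,ab_2\}$. - $\mathcal F_{12}$ consists of the graphs with vertices $a,b_1,b_2,c_1,\dots,c_9$ and edge set $\{ac_i\mid 1\le i\le 8\}\cup\{b_1c_i\mid 1\le i\le 4\}\cup\{b_2c_i\mid 5\le i\le 8\}\cup\{c_1c_2,c_3c_4,c_5c_6,c_7c_9,c_8c_9\}\cup L$ with $L\subseteq\{ab_1,ab_2,ac_9,b_2c_9\}$ and $L\cap\{ac_9,b_2c_9\}\ne\emptyset$. - For integers $2\le s\le t$, the graph $H_{s,t}$ is obtained from vertex-disjoint complete graphs $S_1$, $S_2$ of orders $s-1$, $t-1$ by adding four new vertices $a,b,c_1,c_2$ and the edges $ax$, $bx$ for all $x\in V(S_1)\cup V(S_2)$, together with $ab,ac_1,ac_2,c_1c_2$; the graph $H_{s,t}^-$ is $H_{s,t}$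 with the edge $ab$ deleted; and $\mathcal H_n=\{H_{s,t},H_{s,t}^-\mid 2\le s\le t,\ s+t+2=n\}$. -/

import Mathlib

open Finset

namespace LightIndep

section Invariants

variable {V : Type*} [Fintype V] (G : SimpleGraph V) [DecidableRel G.Adj]

/-- The degree sum `w_G(I)` of a set of vertices. -/
def degSum (I : Finset V) : ℕ := ∑ u ∈ I, G.degree u

/-- The minimum degree `δ_G(I)` over a set of vertices (`⊤` for the empty set). -/
noncomputable def minDegOn (I : Finset V) : ℕ∞ := I.inf (fun u => (G.degree u : ℕ∞))

/-- `I` is large if `|I| ≥ δ_G(I) + 1`. The empty set is not large, since `δ_G(∅) = ⊤`. -/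
def IsLarge (I : Finset V) : Prop := minDegOn G I + 1 ≤ (I.card : ℕ∞)

/-- `I` is light if `w_G(I) ≤ |G| - 1`; the `1` is moved to the left to avoid truncation. -/
def IsLight (I : Finset V) : Prop := degSum G I + 1 ≤ Fintype.card V

/-- The minimum degree sum `σ*(G)` over the large independent sets,
which is `⊤` if there is no large independent set. -/
noncomputable def sigmaStar : ℕ∞ :=
  ⨅ (I : Finset V) (_ : G.IsIndepSet (I : Set V)) (_ : IsLarge G I), (degSum G I : ℕ∞)

open Classical in
/-- The light independence number `α*(G)`: the maximum size of a light independent set. -/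
noncomputable def alphaStar : ℕ :=
  (univ.filter fun I : Finset V => G.IsIndepSet (I : Set V) ∧ IsLight G I).sup Finset.card

end Invariants

/-- A finite graph is `k`-connected if it has more than `k` vertices and deleting fewer than `k`
vertices always leaves a connected graph. -/
def IsKConnected {W : Type*} [Finite W] (k : ℕ) (G : SimpleGraph W) : Prop :=
  k < Nat.card W ∧ ∀ S : Finset W, S.card < k → (G.induce ((S : Set W)ᶜ)).Connected

/-- A partition of the vertex set is `k`-proper if each of its parts induces a `k`-connected
subgraph. -/
def IsKProper {V : Type*} [Fintype V] [DecidableEq V] (G : SimpleGraph V) (k : ℕ)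
    (P : Finpartition (univ : Finset V)) : Prop :=
  ∀ p ∈ P.parts, IsKConnected k (G.induce (p : Set V))

section Exceptional

open Sum

/-- The graph `F₅` on `{a} ∪ {b₁, …, b₄}`, where `a = inl ()` and `bᵢ = inr (i - 1)`:
two triangles sharing the vertex `a`. -/
def F5 : SimpleGraph (Unit ⊕ Fin 4) :=
  SimpleGraph.fromEdgeSet
    ({e | ∃ i : Fin 4, e = s(inl (), inr i)} ∪ {s(inr 0, inr 1), s(inr 2, inr 3)})

/-- The graph on `{a, b₁, b₂} ∪ {c₁, …, c₈}` with the optional edge set `L`,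
where `a = inl 0`, `b₁ = inl 1`, `b₂ = inl 2` and `cᵢ = inr (i - 1)`. -/
def F11 (L : Set (Sym2 (Fin 3 ⊕ Fin 8))) : SimpleGraph (Fin 3 ⊕ Fin 8) :=
  SimpleGraph.fromEdgeSet
    ({e | ∃ i : Fin 8, e = s(inl 0, inr i)} ∪
      {e | ∃ i : Fin 8, i.val < 4 ∧ e = s(inl 1, inr i)} ∪
      {e | ∃ i : Fin 8, 4 ≤ i.val ∧ e = s(inl 2, inr i)} ∪
      {s(inr 0, inr 1), s(inr 2, inr 3), s(inr 4, inr 5), s(inr 6, inr 7)} ∪ L)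

/-- The graph on `{a, b₁, b₂} ∪ {c₁, …, c₉}` with the optional edge set `L`,
where `a = inl 0`, `b₁ = inl 1`, `b₂ = inl 2` and `cᵢ = inr (i - 1)`. -/
def F12 (L : Set (Sym2 (Fin 3 ⊕ Fin 9))) : SimpleGraph (Fin 3 ⊕ Fin 9) :=
  SimpleGraph.fromEdgeSet
    ({e | ∃ i : Fin 9, i.val < 8 ∧ e = s(inl 0, inr i)} ∪
      {e | ∃ i : Fin 9, i.val < 4 ∧ e = s(inl 1, inr i)} ∪
      {e | ∃ i : Fin 9, 4 ≤ i.val ∧ i.val < 8 ∧ e = s(inl 2, inr i)} ∪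
      {s(inr 0, inr 1), s(inr 2, inr 3), s(inr 4, inr 5), s(inr 6, inr 8), s(inr 7, inr 8)} ∪ L)

/-- The graph `H_{s,t}` for `2 ≤ s ≤ t`: here `a = inl 0`, `b = inl 1`, `c₁ = inl 2`, `c₂ = inl 3`,
and the complete graphs `S₁`, `S₂` of orders `s - 1`, `t - 1` live on the vertices
`inr (inl x)` and `inr (inr y)`. -/
def H (s t : ℕ) : SimpleGraph (Fin 4 ⊕ (Fin (s - 1) ⊕ Fin (t - 1))) :=
  SimpleGraph.fromEdgeSet
    ({e | ∃ x y : Fin (s - 1), x ≠ y ∧ e = s(inr (inl x), inr (inl y))} ∪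
      {e | ∃ x y : Fin (t - 1), x ≠ y ∧ e = s(inr (inr x), inr (inr y))} ∪
      {e | ∃ x : Fin (s - 1) ⊕ Fin (t - 1), e = s(inl 0, inr x) ∨ e = s(inl 1, inr x)} ∪
      {s(inl 0, inl 1), s(inl 0, inl 2), s(inl 0, inl 3), s(inl 2, inl 3)})

/-- The graph `H_{s,t}⁻`, obtained from `H_{s,t}` by deleting the edge `ab`. -/
def HMinus (s t : ℕ) : SimpleGraph (Fin 4 ⊕ (Fin (s - 1) ⊕ Fin (t - 1))) :=
  (H s t).deleteEdges {s(inl 0, inl 1)}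

variable {V : Type*} (G : SimpleGraph V)

/-- `G` is isomorphic to a graph in the family `𝓕₁₁`: the optional edges are `ab₁`, `ab₂`. -/
def IsInF11 : Prop :=
  ∃ L : Set (Sym2 (Fin 3 ⊕ Fin 8)), L ⊆ {s(inl 0, inl 1), s(inl 0, inl 2)} ∧
    Nonempty (G ≃g F11 L)

/-- `G` is isomorphic to a graph in the family `𝓕₁₂`: the optional edges are `ab₁`, `ab₂`, `ac₉`,
`b₂c₉`, and at least one of `ac₉`, `b₂c₉` is present. -/
def IsInF12 : Prop :=
  ∃ L : Set (Sym2 (Fin 3 ⊕ Fin 9)),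
    L ⊆ {s(inl 0, inl 1), s(inl 0, inl 2), s(inl 0, inr 8), s(inl 2, inr 8)} ∧
    (L ∩ {s(inl 0, inr 8), s(inl 2, inr 8)}).Nonempty ∧
    Nonempty (G ≃g F12 L)

/-- `G` is isomorphic to a graph in the family `𝓗ₙ`: it is some `H_{s,t}` or `H_{s,t}⁻` with
`2 ≤ s ≤ t` and `s + t + 2 = n`. -/
def IsInH (n : ℕ) : Prop :=
  ∃ s t : ℕ, 2 ≤ s ∧ s ≤ t ∧ s + t + 2 = n ∧ (Nonempty (G ≃g H s t) ∨ Nonempty (G ≃g HMinus s t))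

end Exceptional

end LightIndep

set_option linter.unusedSectionVars false
set_option linter.unusedSimpArgs false

/-! Write n = |V| and α = α*(G), and suppose that V has no cover by α disjoint 2-connected sets. The
aim is to produce an independent set that contradicts σ* ≥ n, unless G has a very restricted shape.

The sets used are those of `Val`: k + 1 + x independent vertices with degree sum at most |H| - 1 +
kx, so that each of the x spare vertices buys an allowance of k. In G itself an exchange argument
(`exists_low_subset`) shows the following: if all (k + 1)-subsets containing a prescribed F have sum
at least n, then one of them has only vertices of degree below k outside F. A maximum light set is
not large, hence α² < n (`alphaStar_sq_lt_card`). Consequently neither a `Val` set with k = α nor a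
`Val` set with k ≤ α containing a vertex of degree at most k can exist (`not_good_univ`).

Such sets come from induction on |H|, cutting at end blocks. A part of the cover can use the cut
vertex z on one side only, which is why some vertices X are declared free. Gluing sets across z
costs one degree per vertex; spare vertices and a larger index pay for it (`Split.val_union`). The
obstruction is K₂, whose vertices have degree one too many. A low pair records this defect: once z
becomes free, at most one vertex of the pair sees z, and the other becomes a low vertex. This gives
`out_of_not_cov`. For X = ∅, `sharpOut_of_not_cov` traces the remaining low pairs to three shapes:
an edge, an edge that is a component of H - z, or a cut vertex with two such branches.

For G, the first shape is K₂. In the other two, large independent sets of two, three or four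
vertices have degree sums so close to the maximum possible that the adjacencies are forced. The
result is F₅ or a member of 𝓗ₙ for one branch, and a member of 𝓕₁₁ or 𝓕₁₂ for two. -/

namespace TwoProper

section Covers

variable {V : Type*} [DecidableEq V] (G : SimpleGraph V) [DecidableRel G.Adj]

/-! ### Degrees inside a set of vertices -/

/-- The number of neighbours of `u` in `H`. -/
def dIn (H : Finset V) (u : V) : ℕ := #{v ∈ H | G.Adj u v}

/-- The sum over `U` of the degrees into `H`. -/
def sumIn (H U : Finset V) : ℕ := ∑ u ∈ U, dIn G H u

/-- There are no edges between `A` and `B`. -/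
def Anti (A B : Finset V) : Prop := ∀ a ∈ A, ∀ b ∈ B, ¬ G.Adj a b

/-- `S` induces a connected graph or is empty. -/
def Conn (S : Finset V) : Prop :=
  ∀ A B : Finset V, A.Nonempty → B.Nonempty → Disjoint A B → A ∪ B = S → ¬ Anti G A B

/-- `S` induces a 2-connected graph. -/
def TwoConn (S : Finset V) : Prop := 3 ≤ #S ∧ Conn G S ∧ ∀ z ∈ S, Conn G (S.erase z)

/-- Deleting `z` from `H` leaves the sets `A` and `B` with no edges between them. -/
structure Split (H : Finset V) (z : V) (A B : Finset V) : Prop where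
  notMem_left : z ∉ A
  notMem_right : z ∉ B
  disj : Disjoint A B
  eq : H = insert z (A ∪ B)
  anti : Anti G A B

variable {G} {H A B C X U U' : Finset V} {u v z : V}

theorem Anti.symm (h : Anti G A B) : Anti G B A := fun b hb a ha hab => h a ha b hb hab.symm

theorem Anti.mono {A' B' : Finset V} (h : Anti G A B) (hA : A' ⊆ A) (hB : B' ⊆ B) :
    Anti G A' B' := fun a ha b hb => h a (hA ha) b (hB hb)

namespace Split

variable (h : Split G H z A B)
include h

theorem symm : Split G H z B A :=
  ⟨h.notMem_right, h.notMem_left, h.disj.symm, by rw [union_comm]; exact h.eq, h.anti.symm⟩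

theorem mem_iff : v ∈ H ↔ v = z ∨ v ∈ A ∨ v ∈ B := by
  rw [h.eq]; simp

theorem left_subset : A ⊆ H := fun _ ha => h.mem_iff.2 (Or.inr (Or.inl ha))

theorem right_subset : B ⊆ H := h.symm.left_subset

theorem insert_subset_left : insert z A ⊆ H := by
  intro v hv
  rw [h.mem_iff]
  rcases mem_insert.1 hv with h | h <;> tauto

theorem mem_center : z ∈ H := h.mem_iff.2 (Or.inl rfl)

theorem card : #H = #A + #B + 1 := by
  rw [h.eq, card_insert_of_notMem (by simp [h.notMem_left, h.notMem_right]),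
    card_union_of_disjoint h.disj]

theorem nbr (ha : u ∈ A) (hv : v ∈ H) (hadj : G.Adj u v) : v ∈ A ∨ v = z := by
  rcases h.mem_iff.1 hv with h1 | h1 | h1
  · exact Or.inr h1
  · exact Or.inl h1
  · exact absurd hadj (h.anti u ha v h1)

end Split

theorem dIn_le_of_nbr (h : ∀ v ∈ H, G.Adj u v → v ∈ A) : dIn G H u ≤ dIn G A u := by
  apply card_le_card
  intro v hv
  simp only [mem_filter] at hv ⊢
  exact ⟨h v hv.1 hv.2, hv.2⟩

theorem dIn_le_of_nbr_insert (h : ∀ v ∈ H, G.Adj u v → v ∈ A ∨ v = z) :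
    dIn G H u ≤ dIn G A u + 1 := by
  refine (card_le_card (t := insert z {v ∈ A | G.Adj u v}) ?_).trans (card_insert_le _ _)
  intro v hv
  simp only [mem_filter, mem_insert] at hv ⊢
  rcases h v hv.1 hv.2 with h1 | h1
  · exact Or.inr ⟨h1, hv.2⟩
  · exact Or.inl h1

theorem dIn_le_card : dIn G H u ≤ #H := card_filter_le _ _

theorem dIn_mono (h : A ⊆ H) : dIn G A u ≤ dIn G H u :=
  dIn_le_of_nbr fun _ hv _ => h hv

theorem dIn_lt_card (hu : u ∈ H) : dIn G H u + 1 ≤ #H := by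
  have : {v ∈ H | G.Adj u v} ⊆ H.erase u := by
    intro v hv
    simp only [mem_filter] at hv
    exact mem_erase.2 ⟨hv.2.ne', hv.1⟩
  have h1 := card_le_card this
  have h2 := card_erase_add_one hu
  unfold dIn
  omega

theorem Split.dIn_le (h : Split G H z A B) (hu : u ∈ A) : dIn G H u ≤ dIn G A u + 1 :=
  dIn_le_of_nbr_insert fun _ hv hadj => h.nbr hu hv hadj

theorem Split.dIn_sdiff_le (h : Split G H z A B) (hu : u ∈ A) :
    dIn G (H \ X) u ≤ dIn G (A \ X) u + 1 := by
  refine dIn_le_of_nbr_insert (z := z) fun v hv hadj => ?_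
  simp only [mem_sdiff] at hv ⊢
  rcases h.nbr hu hv.1 hadj with h1 | h1
  · exact Or.inl ⟨h1, hv.2⟩
  · exact Or.inr h1

theorem Split.dIn_sdiff_le_of_mem (h : Split G H z A B) (hu : u ∈ A) (hz : z ∈ X) :
    dIn G (H \ X) u ≤ dIn G (A \ X) u := by
  refine dIn_le_of_nbr fun v hv hadj => ?_
  simp only [mem_sdiff] at hv ⊢
  rcases h.nbr hu hv.1 hadj with h1 | h1
  · exact ⟨h1, hv.2⟩
  · subst h1; exact absurd hz hv.2

theorem sumIn_union (h : Disjoint U U') : sumIn G H (U ∪ U') = sumIn G H U + sumIn G H U' :=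
  sum_union h

theorem sumIn_le_add_card {A : Finset V} (h : ∀ u ∈ U, dIn G H u ≤ dIn G A u + 1) :
    sumIn G H U ≤ sumIn G A U + #U := by
  refine (sum_le_sum h).trans ?_
  rw [sum_add_distrib]
  simp [sumIn]

theorem sumIn_le_of_le {A : Finset V} (h : ∀ u ∈ U, dIn G H u ≤ dIn G A u) :
    sumIn G H U ≤ sumIn G A U := sum_le_sum h

theorem sumIn_singleton : sumIn G H {u} = dIn G H u := by simp [sumIn]

/-! ### Covers by disjoint 2-connected sets -/

variable (G) in
/-- `H \ X` can be covered by at most `m` disjoint subsets of `H` inducing 2-connected graphs. -/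
def Cov (H X : Finset V) (m : ℕ) : Prop :=
  ∃ P : Finset (Finset V), (∀ p ∈ P, TwoConn G p ∧ p ⊆ H) ∧
    (P : Set (Finset V)).PairwiseDisjoint id ∧ (∀ v ∈ H, v ∉ X → ∃ p ∈ P, v ∈ p) ∧ #P ≤ m

theorem TwoConn.nonempty (h : TwoConn G A) : A.Nonempty := by
  rw [← card_pos]; have := h.1; omega

theorem Cov.add {Y Z : Finset V} {i j m : ℕ} (hA : Cov G A X i) (hB : Cov G B Y j)
    (hd : Disjoint A B) (hAC : A ⊆ C) (hBC : B ⊆ C) (hm : i + j ≤ m)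
    (hc : ∀ v ∈ C, v ∉ Z → v ∈ A ∧ v ∉ X ∨ v ∈ B ∧ v ∉ Y) : Cov G C Z m := by
  obtain ⟨P, hP, hPd, hPc, hPm⟩ := hA
  obtain ⟨Q, hQ, hQd, hQc, hQm⟩ := hB
  refine ⟨P ∪ Q, ?_, ?_, ?_, (card_union_le _ _).trans (by omega)⟩
  · intro p hp
    rcases mem_union.1 hp with h | h
    · exact ⟨(hP p h).1, (hP p h).2.trans hAC⟩
    · exact ⟨(hQ p h).1, (hQ p h).2.trans hBC⟩
  · rw [coe_union]
    refine hPd.union hQd fun p hp q hq _ => ?_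
    exact Finset.disjoint_of_subset_left (hP p hp).2 (Finset.disjoint_of_subset_right (hQ q hq).2 hd)
  · intro v hv hvZ
    rcases hc v hv hvZ with ⟨h1, h2⟩ | ⟨h1, h2⟩
    · obtain ⟨p, hp, hvp⟩ := hPc v h1 h2
      exact ⟨p, mem_union_left _ hp, hvp⟩
    · obtain ⟨p, hp, hvp⟩ := hQc v h1 h2
      exact ⟨p, mem_union_right _ hp, hvp⟩

theorem Cov.extend {Z : Finset V} {i m : ℕ} (hA : Cov G A X i) (hAC : A ⊆ C) (hm : i ≤ m)
    (hc : ∀ v ∈ C, v ∉ Z → v ∈ A ∧ v ∉ X) : Cov G C Z m := by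
  obtain ⟨P, hP, hPd, hPc, hPm⟩ := hA
  exact ⟨P, fun p hp => ⟨(hP p hp).1, (hP p hp).2.trans hAC⟩, hPd,
    fun v hv hvZ => hPc v (hc v hv hvZ).1 (hc v hv hvZ).2, hPm.trans hm⟩

theorem Cov.mono {i m : ℕ} (hA : Cov G A X i) (hm : i ≤ m) : Cov G A X m :=
  hA.extend subset_rfl hm fun _ h1 h2 => ⟨h1, h2⟩

theorem TwoConn.cov (h : TwoConn G A) : Cov G A X 1 :=
  ⟨{A}, by simpa using h, by simp, fun v hv _ => ⟨A, by simp, hv⟩, by simp⟩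

theorem cov_of_subset (h : H ⊆ X) (m : ℕ) : Cov G H X m :=
  ⟨∅, by simp, by simp, fun v hv hvX => absurd (h hv) hvX, by simp⟩

theorem exists_mem_of_not_cov {m : ℕ} (h : ¬ Cov G H X m) : ∃ u ∈ H, u ∉ X := by
  by_contra! hc
  exact h (cov_of_subset hc m)

/-- Either some part uses z, and then z is covered after all, or no part does, and then the parts
lie in A. -/
theorem Cov.of_insert_free {m : ℕ} (hz : z ∉ A) (h : Cov G (insert z A) (insert z X) m) :
    Cov G (insert z A) X m ∨ Cov G A X m := by
  obtain ⟨P, hP, hPd, hPc, hPm⟩ := h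
  by_cases hzP : ∃ p ∈ P, z ∈ p
  · left
    refine ⟨P, hP, hPd, fun v hv hvX => ?_, hPm⟩
    by_cases hvz : v = z
    · subst hvz; exact hzP
    · exact hPc v hv (by simp [hvz, hvX])
  · right
    push Not at hzP
    refine ⟨P, fun p hp => ⟨(hP p hp).1, fun v hv => ?_⟩, hPd, fun v hv hvX => ?_, hPm⟩
    · rcases mem_insert.1 ((hP p hp).2 hv) with h | h
      · subst h; exact absurd hv (hzP p hp)
      · exact h
    · refine hPc v (mem_insert_of_mem hv) ?_
      rw [mem_insert, not_or]
      exact ⟨fun h => hz (h ▸ hv), hvX⟩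

/-! ### Independent sets of small degree sum -/

variable (G) in
/-- `U` is an independent set of `k + 1 + x` vertices of `H` outside `X` whose degree sum in `H`
is at most `|H| - 1 + k x`. -/
def Val (H X : Finset V) (k : ℕ) (U : Finset V) : Prop :=
  (∀ u ∈ U, u ∈ H ∧ u ∉ X) ∧ (∀ u ∈ U, ∀ v ∈ U, ¬ G.Adj u v) ∧
    ∃ x, #U = k + 1 + x ∧ sumIn G H U + 1 ≤ #H + k * x

variable (G) in
/-- A vertex `u` of degree at most `k` outside `X` lies in a set as in `Val`. -/
def LowVertex (H X : Finset V) (k : ℕ) : Prop :=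
  ∃ U u, Val G H X k U ∧ u ∈ U ∧ dIn G (H \ X) u ≤ k

variable (G) in
/-- Two vertices of degree at most `k + 1` outside `X`, without a common neighbour in `X`,
lie in sets as in `Val`. -/
def LowPair (H X : Finset V) (k : ℕ) : Prop :=
  ∃ U U' u u', Val G H X k U ∧ Val G H X k U' ∧ u ∈ U ∧ u' ∈ U' ∧ u ≠ u' ∧
    dIn G (H \ X) u ≤ k + 1 ∧ dIn G (H \ X) u' ≤ k + 1 ∧
    ∀ x ∈ H, x ∈ X → ¬ (G.Adj u x ∧ G.Adj u' x)

variable (G) in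
/-- Either a set as in `Val` or a low vertex exists. -/
def Good (H X : Finset V) (k : ℕ) : Prop :=
  (∃ U, Val G H X k U) ∨ ∃ i ≤ k, LowVertex G H X i

variable (G) in
/-- The weaker outcome that also admits a low pair. -/
def Out (H X : Finset V) (k : ℕ) : Prop :=
  Good G H X k ∨ ∃ i < k, LowPair G H X i

theorem LowVertex.good {i k : ℕ} (h : LowVertex G H X i) (hik : i ≤ k) : Good G H X k :=
  Or.inr ⟨i, hik, h⟩

theorem Val.good {k : ℕ} (h : Val G H X k U) : Good G H X k := Or.inl ⟨U, h⟩

theorem Good.out {k : ℕ} (h : Good G H X k) : Out G H X k := Or.inl h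

theorem val_singleton (hu : u ∈ H) (huX : u ∉ X) : Val G H X 0 {u} := by
  refine ⟨by simp [hu, huX], by simp, 0, by simp, ?_⟩
  rw [sumIn_singleton]
  simpa using dIn_lt_card hu

/-- Each of the i + j + 2 + x + y vertices may gain the neighbour z. This raises the bound to |H| -
1 + (i + j) + (i + 1)x + (j + 1)y. At index k the union has t + x + y spare vertices, and the
inequalities on i, j, t say exactly that their allowance suffices. -/
theorem Split.val_union (h : Split G H z A B) {i j k t : ℕ} (hU : Val G A X i U)
    (hU' : Val G B X j U') (hi : i + 1 ≤ k) (hj : j + 1 ≤ k) (ht : i + j + 1 = k + t)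
    (hk : i + j ≤ k * t) : Val G H X k (U ∪ U') := by
  obtain ⟨h1, h2, x, h3, h4⟩ := hU
  obtain ⟨h1', h2', y, h3', h4'⟩ := hU'
  have hd : Disjoint U U' := by
    rw [disjoint_left]
    intro a ha ha'
    exact disjoint_left.1 h.disj (h1 a ha).1 (h1' a ha').1
  refine ⟨?_, ?_, t + x + y, ?_, ?_⟩
  · intro u hu
    rcases mem_union.1 hu with hu | hu
    · exact ⟨h.left_subset (h1 u hu).1, (h1 u hu).2⟩
    · exact ⟨h.right_subset (h1' u hu).1, (h1' u hu).2⟩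
  · intro u hu v hv
    rcases mem_union.1 hu with hu | hu <;> rcases mem_union.1 hv with hv | hv
    · exact h2 u hu v hv
    · exact h.anti u (h1 u hu).1 v (h1' v hv).1
    · exact h.symm.anti u (h1' u hu).1 v (h1 v hv).1
    · exact h2' u hu v hv
  · rw [card_union_of_disjoint hd]; omega
  · rw [sumIn_union hd, h.card]
    have e1 : sumIn G H U ≤ sumIn G A U + #U := sumIn_le_add_card fun u hu => h.dIn_le (h1 u hu).1
    have e2 : sumIn G H U' ≤ sumIn G B U' + #U' :=
      sumIn_le_add_card fun u hu => h.symm.dIn_le (h1' u hu).1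
    have e3 : (i + 1) * x ≤ k * x := Nat.mul_le_mul_right _ hi
    have e4 : (j + 1) * y ≤ k * y := Nat.mul_le_mul_right _ hj
    have e5 : k * (t + x + y) = k * t + k * x + k * y := by ring
    have e6 : (i + 1) * x = i * x + x := by ring
    have e7 : (j + 1) * y = j * y + y := by ring
    omega

theorem Split.lowVertex_union (h : Split G H z A B) {i j k t : ℕ} (hU : LowVertex G A X i)
    (hU' : Val G B X j U') (hi : i + 1 ≤ k) (hj : j + 1 ≤ k) (ht : i + j + 1 = k + t)
    (hk : i + j ≤ k * t) : LowVertex G H X k := by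
  obtain ⟨U, u, hU, hu, hdeg⟩ := hU
  refine ⟨U ∪ U', u, h.val_union hU hU' hi hj ht hk, mem_union_left _ hu, ?_⟩
  have := h.dIn_sdiff_le (X := X) (hU.1 u hu).1
  omega

/-- A vertex of a low pair has degree at most i + 1, and z adds one. An index increase of two
therefore turns it into a low vertex without using its partner. -/
theorem Split.lowVertex_of_lowPair (h : Split G H z A B) {i j k t : ℕ} (hU : LowPair G A X i)
    (hU' : Val G B X j U') (hi : i + 2 ≤ k) (hj : j + 1 ≤ k) (ht : i + j + 1 = k + t)
    (hk : i + j ≤ k * t) : LowVertex G H X k := by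
  obtain ⟨U, _, u, _, hU, _, hu, _, _, hdeg, _⟩ := hU
  refine ⟨U ∪ U', u, h.val_union hU hU' (by omega) hj ht hk, mem_union_left _ hu, ?_⟩
  have := h.dIn_sdiff_le (X := X) (hU.1 u hu).1
  omega

/-- If z is free, degrees outside X do not grow and one vertex of the pair is already low for i + 1.
Otherwise both degrees grow by at most one, and the only possible new common neighbour, z, is not in
X. -/
theorem Split.lowPair_union (h : Split G H z A B) {i j t : ℕ} (hU : LowPair G A X i)
    (hU' : Val G B X j U') (hj : j ≤ i) (ht : j = t)
    (hk : i + j ≤ (i + 1) * t) : LowVertex G H X (i + 1) ∨ LowPair G H X (i + 1) := by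
  obtain ⟨U₁, U₂, u₁, u₂, hU₁, hU₂, hu₁, hu₂, hne, hd₁, hd₂, hx⟩ := hU
  have v₁ : Val G H X (i + 1) (U₁ ∪ U') := h.val_union hU₁ hU' (by omega) (by omega) (by omega) hk
  have v₂ : Val G H X (i + 1) (U₂ ∪ U') := h.val_union hU₂ hU' (by omega) (by omega) (by omega) hk
  by_cases hz : z ∈ X
  · left
    refine ⟨U₁ ∪ U', u₁, v₁, mem_union_left _ hu₁, ?_⟩
    exact (h.dIn_sdiff_le_of_mem (hU₁.1 u₁ hu₁).1 hz).trans hd₁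
  · right
    refine ⟨U₁ ∪ U', U₂ ∪ U', u₁, u₂, v₁, v₂, mem_union_left _ hu₁, mem_union_left _ hu₂, hne,
      ?_, ?_, ?_⟩
    · have := h.dIn_sdiff_le (X := X) (hU₁.1 u₁ hu₁).1
      omega
    · have := h.dIn_sdiff_le (X := X) (hU₂.1 u₂ hu₂).1
      omega
    · rintro x hxH hxX ⟨hx₁, hx₂⟩
      rcases h.nbr (hU₁.1 u₁ hu₁).1 hxH hx₁ with h1 | h1
      · exact hx x h1 hxX ⟨hx₁, hx₂⟩
      · subst h1; exact hz hxX

/-! ### Connectivity -/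

theorem Conn.exists_adj (h : Conn G (A ∪ B)) (hA : A.Nonempty) (hB : B.Nonempty)
    (hd : Disjoint A B) : ∃ a ∈ A, ∃ b ∈ B, G.Adj a b := by
  have := h A B hA hB hd rfl
  unfold Anti at this
  push Not at this
  exact this

theorem not_conn_iff : ¬ Conn G H ↔
    ∃ A B : Finset V, A.Nonempty ∧ B.Nonempty ∧ Disjoint A B ∧ A ∪ B = H ∧ Anti G A B := by
  simp only [Conn, not_forall, not_not, exists_prop]

/-- If `Conn G S` fails and `z ∈ S`, one side of a separation avoids `z`. -/
theorem exists_side_notMem (hz : z ∈ H) (h : ¬ Conn G H) :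
    ∃ C D : Finset V, z ∈ C ∧ D.Nonempty ∧ Disjoint C D ∧ C ∪ D = H ∧ Anti G C D := by
  obtain ⟨A, B, hA, hB, hd, he, ha⟩ := not_conn_iff.1 h
  rw [← he, mem_union] at hz
  rcases hz with hz | hz
  · exact ⟨A, B, hz, hB, hd, he, ha⟩
  · exact ⟨B, A, hz, hA, hd.symm, by rw [union_comm, he], ha.symm⟩

theorem Split.of_erase (hz : z ∈ H) (hd : Disjoint A B) (he : A ∪ B = H.erase z)
    (ha : Anti G A B) : Split G H z A B := by
  have h1 : z ∉ A ∪ B := by rw [he]; simp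
  rw [mem_union, not_or] at h1
  exact ⟨h1.1, h1.2, hd, by rw [he, insert_erase hz], ha⟩

theorem exists_split (hc : Conn G H) (h3 : 3 ≤ #H) (h : ¬ TwoConn G H) :
    ∃ z A B, Split G H z A B ∧ A.Nonempty ∧ B.Nonempty := by
  unfold TwoConn at h
  push Not at h
  obtain ⟨z, hz, hn⟩ := h h3 hc
  obtain ⟨A, B, hA, hB, hd, he, ha⟩ := not_conn_iff.1 hn
  exact ⟨z, A, B, Split.of_erase hz hd he ha, hA, hB⟩

theorem Split.conn_insert_right (h : Split G H z A B) (hc : Conn G H) :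
    Conn G (insert z B) := by
  by_contra hn
  obtain ⟨C, D, hzC, hD, hd, he, ha⟩ := exists_side_notMem (mem_insert_self z B) hn
  have hDB : D ⊆ B := by
    intro v hv
    have : v ∈ insert z B := he ▸ mem_union_right _ hv
    rcases mem_insert.1 this with h1 | h1
    · subst h1; exact absurd hv (disjoint_left.1 hd hzC)
    · exact h1
  refine hc (A ∪ C) D ⟨z, mem_union_right _ hzC⟩ hD ?_ ?_ ?_
  · rw [disjoint_union_left]
    exact ⟨disjoint_of_subset_right hDB h.disj, hd⟩
  · rw [union_assoc, he, h.eq]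
    ext v; simp
  · intro a ha' b hb
    rcases mem_union.1 ha' with h1 | h1
    · exact h.anti a h1 b (hDB hb)
    · exact ha a h1 b hb

/-- Every side of a separation of order one contains an end block without its cut vertex. -/
theorem exists_endblock (hc : Conn G H) {z₀ : V} {A₀ B₀ : Finset V} (h : Split G H z₀ A₀ B₀)
    (hA : A₀.Nonempty) (hB : B₀.Nonempty) :
    ∃ z A B, Split G H z A B ∧ A.Nonempty ∧ B.Nonempty ∧ B ⊆ B₀ ∧
      ((∃ v, B = {v}) ∨ TwoConn G (insert z B)) := by
  -- Extremal choice: among all separations with a side inside `B₀`, take one whose side B is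
  -- smallest.
  have key : ∃ n z A B, #B = n ∧ Split G H z A B ∧ A.Nonempty ∧ B.Nonempty ∧ B ⊆ B₀ :=
    ⟨_, z₀, A₀, B₀, rfl, h, hA, hB, subset_rfl⟩
  classical
  obtain ⟨z, A, B, hn, hs, hA, hB, hBB⟩ := Nat.find_spec key
  have hmin : ∀ z' A' B', Split G H z' A' B' → A'.Nonempty → B'.Nonempty → B' ⊆ B₀ →
      #B ≤ #B' := by
    intro z' A' B' h1 h2 h3 h4
    rw [hn]
    exact Nat.find_min' key ⟨z', A', B', rfl, h1, h2, h3, h4⟩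
  refine ⟨z, A, B, hs, hA, hB, hBB, ?_⟩
  by_cases h1 : #B = 1
  · exact Or.inl (card_eq_one.1 h1)
  right
  have h2 : 2 ≤ #B := by have := card_pos.2 hB; omega
  refine ⟨by rw [card_insert_of_notMem hs.notMem_right]; omega, hs.conn_insert_right hc, ?_⟩
  intro w hw
  by_contra hnc
  rcases eq_or_ne w z with rfl | hwz
  · rw [erase_insert hs.notMem_right] at hnc
    obtain ⟨C, D, hC, hD, hd, he, ha⟩ := not_conn_iff.1 hnc
    have hCB : C ⊆ B := he ▸ subset_union_left
    have hDB : D ⊆ B := he ▸ subset_union_right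
    -- If B itself is disconnected, moving C to the far side of z leaves the smaller side D.
    have := hmin w (A ∪ C) D ⟨?_, ?_, ?_, ?_, ?_⟩ (hA.mono subset_union_left) hD (hDB.trans hBB)
    · have h5 : #B = #C + #D := by rw [← he, card_union_of_disjoint hd]
      have := card_pos.2 hC
      omega
    · simp only [mem_union, not_or]
      exact ⟨hs.notMem_left, fun hx => hs.notMem_right (hCB hx)⟩
    · exact fun hx => hs.notMem_right (hDB hx)
    · rw [disjoint_union_left]
      exact ⟨disjoint_of_subset_right hDB hs.disj, hd⟩
    · rw [union_assoc, he, hs.eq]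
    · intro a ha' b hb
      rcases mem_union.1 ha' with h1 | h1
      · exact hs.anti a h1 b (hDB hb)
      · exact ha a h1 b hb
  · have hwB : w ∈ B := by
      rcases mem_insert.1 hw with h | h
      · exact absurd h hwz
      · exact h
    have hzm : z ∈ (insert z B).erase w := mem_erase.2 ⟨hwz.symm, mem_insert_self _ _⟩
    obtain ⟨C, D, hzC, hD, hd, he, ha⟩ := exists_side_notMem hzm hnc
    have hDB : D ⊆ B.erase w := by
      intro v hv
      have hv' : v ∈ (insert z B).erase w := he ▸ mem_union_right _ hv
      rw [mem_erase, mem_insert] at hv'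
      rcases hv'.2 with h1 | h1
      · subst h1; exact absurd hv (disjoint_left.1 hd hzC)
      · exact mem_erase.2 ⟨hv'.1, h1⟩
    have hwC : w ∉ C := fun hx => by
      have : w ∈ (insert z B).erase w := he ▸ mem_union_left _ hx
      simp at this
    have hwA : w ∉ A := fun hx => disjoint_left.1 hs.disj hx hwB
    -- The side D of z + B - w that avoids z is cut off from the rest of H by w alone, and it is
    -- smaller than B.
    have := hmin w (A ∪ C) D ⟨?_, ?_, ?_, ?_, ?_⟩ (hA.mono subset_union_left) hD
      (hDB.trans ((erase_subset _ _).trans hBB))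
    · have h6 := card_le_card hDB
      have h5 := card_erase_add_one hwB
      omega
    · simp [hwA, hwC]
    · exact fun hx => by simpa using hDB hx
    · rw [disjoint_union_left]
      exact ⟨disjoint_of_subset_right (hDB.trans (erase_subset _ _)) hs.disj, hd⟩
    · rw [union_assoc, he, hs.eq]
      ext v
      by_cases hvw : v = w
      · subst hvw; simp [hwB]
      · simp [hvw]; tauto
    · intro a ha' b hb
      rcases mem_union.1 ha' with h1 | h1
      · exact hs.anti a h1 b (mem_of_mem_erase (hDB hb))
      · exact ha a h1 b hb

/-- Two vertices on different sides of a separation have small degree sum. -/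
theorem exists_val_one (h3 : 3 ≤ #H) (h : ¬ TwoConn G H) :
    ∃ b ∈ H, ∃ b' ∈ H, b ≠ b' ∧ ¬ G.Adj b b' ∧ dIn G H b + dIn G H b' + 1 ≤ #H := by
  by_cases hc : Conn G H
  · obtain ⟨z, A, B, hs, ⟨a, ha⟩, ⟨b, hb⟩⟩ := exists_split hc h3 h
    refine ⟨a, hs.left_subset ha, b, hs.right_subset hb, ?_, hs.anti a ha b hb, ?_⟩
    · rintro rfl; exact disjoint_left.1 hs.disj ha hb
    · have h1 := hs.dIn_le ha
      have h2 := hs.symm.dIn_le hb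
      have h3 := dIn_lt_card (G := G) ha
      have h4 := dIn_lt_card (G := G) hb
      have h5 := hs.card
      omega
  · obtain ⟨A, B, ⟨a, ha⟩, ⟨b, hb⟩, hd, rfl, hanti⟩ := not_conn_iff.1 hc
    refine ⟨a, mem_union_left _ ha, b, mem_union_right _ hb, ?_, hanti a ha b hb, ?_⟩
    · rintro rfl; exact disjoint_left.1 hd ha hb
    · have h1 : dIn G (A ∪ B) a ≤ dIn G A a := dIn_le_of_nbr fun v hv hadj => by
        rcases mem_union.1 hv with h | h
        · exact h
        · exact absurd hadj (hanti a ha v h)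
      have h2 : dIn G (A ∪ B) b ≤ dIn G B b := dIn_le_of_nbr fun v hv hadj => by
        rcases mem_union.1 hv with h | h
        · exact absurd hadj.symm (hanti v h b hb)
        · exact h
      have h3 := dIn_lt_card (G := G) ha
      have h4 := dIn_lt_card (G := G) hb
      rw [card_union_of_disjoint hd]
      omega

/-! ### Sufficient conditions for 2-connectedness -/

theorem conn_of_common (h : ∀ u ∈ H, ∀ v ∈ H, u ≠ v → ¬ G.Adj u v →
    ∃ w ∈ H, G.Adj u w ∧ G.Adj w v) : Conn G H := by
  rintro A B ⟨a, ha⟩ ⟨b, hb⟩ hd rfl hanti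
  obtain ⟨w, hw, h1, h2⟩ := h a (mem_union_left _ ha) b (mem_union_right _ hb)
    (by rintro rfl; exact disjoint_left.1 hd ha hb) (hanti a ha b hb)
  rcases mem_union.1 hw with hw | hw
  · exact hanti w hw b hb h2
  · exact hanti a ha w hw h1

theorem twoConn_of_common (h3 : 3 ≤ #H) (h : ∀ u ∈ H, ∀ v ∈ H, u ≠ v → ¬ G.Adj u v →
    ∃ w ∈ H, ∃ w' ∈ H, w ≠ w' ∧ G.Adj u w ∧ G.Adj w v ∧ G.Adj u w' ∧ G.Adj w' v) :
    TwoConn G H := by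
  refine ⟨h3, conn_of_common fun u hu v hv huv hadj => ?_, fun z hz =>
    conn_of_common fun u hu v hv huv hadj => ?_⟩
  · obtain ⟨w, hw, _, _, _, h1, h2, _⟩ := h u hu v hv huv hadj
    exact ⟨w, hw, h1, h2⟩
  · obtain ⟨w, hw, w', hw', hne, h1, h2, h3, h4⟩ :=
      h u (mem_of_mem_erase hu) v (mem_of_mem_erase hv) huv hadj
    by_cases hwz : w = z
    · exact ⟨w', mem_erase.2 ⟨fun e => hne (hwz.trans e.symm), hw'⟩, h3, h4⟩
    · exact ⟨w, mem_erase.2 ⟨hwz, hw⟩, h1, h2⟩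

theorem Conn.insert_vertex {g s : V} (h : Conn G H) (hs : s ∈ H) (hg : G.Adj g s) :
    Conn G (insert g H) := by
  by_contra hn
  obtain ⟨C, D, hC, hD, hd, he, ha⟩ := exists_side_notMem (mem_insert_of_mem hs) hn
  have hgC : g ∈ C := by
    by_contra hgC
    have : g ∈ C ∪ D := he ▸ mem_insert_self g H
    rcases mem_union.1 this with h1 | h1
    · exact hgC h1
    · exact ha s hC g h1 hg.symm
  have hgD : g ∉ D := disjoint_left.1 hd hgC
  have hgs : g ≠ s := hg.ne
  by_cases hgH : g ∈ H
  · rw [insert_eq_of_mem hgH] at he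
    exact h C D ⟨s, hC⟩ hD hd he ha
  · refine h (C.erase g) D ⟨s, mem_erase.2 ⟨hgs.symm, hC⟩⟩ hD
      (disjoint_of_subset_left (erase_subset _ _) hd) ?_ (ha.mono (erase_subset _ _) subset_rfl)
    rw [← erase_insert hgH, ← he, erase_union_distrib, erase_eq_of_notMem hgD]

theorem TwoConn.insert_vertex {g s s' : V} (h : TwoConn G H) (hgH : g ∉ H) (hs : s ∈ H) (hs' : s' ∈ H)
    (hss : s ≠ s') (hg : G.Adj g s) (hg' : G.Adj g s') : TwoConn G (insert g H) := by
  refine ⟨h.1.trans (card_le_card (subset_insert _ _)), h.2.1.insert_vertex hs hg, fun z hz => ?_⟩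
  by_cases hzg : z = g
  · subst hzg; rw [erase_insert hgH]; exact h.2.1
  have hzH : z ∈ H := (mem_insert.1 hz).resolve_left hzg
  rw [erase_insert_of_ne (Ne.symm hzg)]
  by_cases hzs : s = z
  · exact (h.2.2 z hzH).insert_vertex (mem_erase.2 ⟨fun e => hss (hzs.trans e.symm), hs'⟩) hg'
  · exact (h.2.2 z hzH).insert_vertex (mem_erase.2 ⟨hzs, hs⟩) hg

/-! ### Combining independent sets -/

theorem Val.lift {A' : Finset V} {k : ℕ} (hU : Val G A' X k U) (hAH : A' ⊆ H)
    (hsum : sumIn G H U + #A' ≤ sumIn G A' U + #H) : Val G H X k U := by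
  obtain ⟨h1, h2, x, h3, h4⟩ := hU
  exact ⟨fun u hu => ⟨hAH (h1 u hu).1, (h1 u hu).2⟩, h2, x, h3, by omega⟩

/-- Transfers an outcome to a larger vertex set when the degree sums grow by no more than the number
of added vertices, degrees outside X do not grow, and no added vertex is a common neighbour. -/
theorem Out.lift {A' : Finset V} {k : ℕ} (hAH : A' ⊆ H)
    (hsum : ∀ U ⊆ A', sumIn G H U + #A' ≤ sumIn G A' U + #H)
    (hdeg : ∀ u ∈ A', dIn G (H \ X) u ≤ dIn G (A' \ X) u)
    (hx : ∀ u ∈ A', ∀ u' ∈ A', u ≠ u' → ∀ x ∈ H, x ∉ A' → ¬ (G.Adj u x ∧ G.Adj u' x))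
    (h : Out G A' X k) : Out G H X k := by
  have hl : ∀ {i U}, Val G A' X i U → Val G H X i U := fun {i U} hU =>
    hU.lift hAH (hsum U fun u hu => (hU.1 u hu).1)
  rcases h with (⟨U, hU⟩ | ⟨i, hi, U, u, hU, hu, hd⟩) |
    ⟨i, hi, U, U', u, u', hU, hU', hu, hu', hne, hd, hd', hxx⟩
  · exact (hl hU).good.out
  · exact Or.inl (Or.inr ⟨i, hi, U, u, hl hU, hu, (hdeg u (hU.1 u hu).1).trans hd⟩)
  · refine Or.inr ⟨i, hi, U, U', u, u', hl hU, hl hU', hu, hu', hne,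
      (hdeg u (hU.1 u hu).1).trans hd, (hdeg u' (hU'.1 u' hu').1).trans hd', ?_⟩
    intro x hxH hxX
    by_cases hxA : x ∈ A'
    · exact hxx x hxA hxX
    · exact hx u (hU.1 u hu).1 u' (hU'.1 u' hu').1 hne x hxH hxA

theorem Out.cases {k : ℕ} (h : Out G H X k) :
    (∃ U, Val G H X k U) ∨ ∃ i ≤ k, LowVertex G H X i ∨ LowPair G H X i := by
  rcases h with (h | ⟨i, hi, h⟩) | ⟨i, hi, h⟩
  · exact Or.inl h
  · exact Or.inr ⟨i, hi, Or.inl h⟩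
  · exact Or.inr ⟨i, hi.le, Or.inr h⟩

/-! ### Gluing along a disconnection -/

section Disjoint

variable (hd : Disjoint A B) (ha : Anti G A B)
include hd ha

theorem dIn_union_le (hu : u ∈ A) : dIn G (A ∪ B) u ≤ dIn G A u :=
  dIn_le_of_nbr fun v hv hadj => (mem_union.1 hv).resolve_right fun h => ha u hu v h hadj

theorem dIn_union_sdiff_le (hu : u ∈ A) : dIn G ((A ∪ B) \ X) u ≤ dIn G (A \ X) u :=
  dIn_le_of_nbr fun v hv hadj => by
    rw [mem_sdiff] at hv ⊢
    exact ⟨(mem_union.1 hv.1).resolve_right fun h => ha u hu v h hadj, hv.2⟩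

/-- Without a cut vertex no degree grows, and the indices add up as i + 1 and j + 1 do. -/
theorem val_union {i j k : ℕ} (hU : Val G A X i U) (hU' : Val G B X j U') (hk : i + j + 1 = k) :
    Val G (A ∪ B) X k (U ∪ U') := by
  obtain ⟨h1, h2, x, h3, h4⟩ := hU
  obtain ⟨h1', h2', y, h3', h4'⟩ := hU'
  have hdU : Disjoint U U' := by
    rw [disjoint_left]
    intro a ha ha'
    exact disjoint_left.1 hd (h1 a ha).1 (h1' a ha').1
  refine ⟨?_, ?_, x + y, ?_, ?_⟩
  · intro u hu
    rcases mem_union.1 hu with hu | hu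
    · exact ⟨mem_union_left _ (h1 u hu).1, (h1 u hu).2⟩
    · exact ⟨mem_union_right _ (h1' u hu).1, (h1' u hu).2⟩
  · intro u hu v hv
    rcases mem_union.1 hu with hu | hu <;> rcases mem_union.1 hv with hv | hv
    · exact h2 u hu v hv
    · exact ha u (h1 u hu).1 v (h1' v hv).1
    · exact ha.symm u (h1' u hu).1 v (h1 v hv).1
    · exact h2' u hu v hv
  · rw [card_union_of_disjoint hdU]; omega
  · rw [sumIn_union hdU, card_union_of_disjoint hd]
    have e1 : sumIn G (A ∪ B) U ≤ sumIn G A U :=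
      sumIn_le_of_le fun u hu => dIn_union_le hd ha (h1 u hu).1
    have e2 : sumIn G (A ∪ B) U' ≤ sumIn G B U' :=
      sumIn_le_of_le fun u hu => by
        rw [union_comm]; exact dIn_union_le hd.symm ha.symm (h1' u hu).1
    have e3 : k * (x + y) = i * x + j * y + ((j + 1) * x + (i + 1) * y) := by subst hk; ring
    omega

/-- Adding one vertex from the other side raises the index by one. This is just what the weaker
degree bound of a low pair needs, so low pairs disappear in disconnected sets. -/
theorem lowVertex_union_of_single {b : V} {i : ℕ} (hb : b ∈ B) (hbX : b ∉ X)
    (h : LowVertex G A X i ∨ LowPair G A X i) : LowVertex G (A ∪ B) X (i + 1) := by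
  have hV := val_singleton (G := G) hb hbX
  rcases h with ⟨U, u, hU, hu, hdeg⟩ | ⟨U, _, u, _, hU, _, hu, _, _, hdeg, _⟩
  all_goals
    refine ⟨_, u, val_union hd ha hU hV rfl, mem_union_left _ hu, ?_⟩
    have := dIn_union_sdiff_le (X := X) hd ha (hU.1 u hu).1
    omega

theorem good_union_of_single {b : V} {i : ℕ} (hb : b ∈ B) (hbX : b ∉ X) (h : Out G A X i) :
    Good G (A ∪ B) X (i + 1) := by
  rcases h.cases with ⟨U, hU⟩ | ⟨j, hj, hU⟩
  · exact (val_union hd ha hU (val_singleton hb hbX) rfl).good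
  · exact (lowVertex_union_of_single hd ha hb hbX hU).good (by omega)

theorem out_union_of_free {k : ℕ} (h : Out G A X k) : Out G (A ∪ B) X k := by
  refine h.lift subset_union_left (fun U hU => ?_)
    (fun u hu => dIn_union_sdiff_le hd ha hu) ?_
  · have := sumIn_le_of_le (G := G) (U := U) fun u hu => dIn_union_le hd ha (hU hu)
    rw [card_union_of_disjoint hd]
    omega
  · rintro u hu u' - - x hx hxA ⟨h1, -⟩
    exact ha u hu x ((mem_union.1 hx).resolve_left hxA) h1

theorem good_union {a b : V} {k : ℕ} (haA : a ∈ A) (haX : a ∉ X) (hb : b ∈ B) (hbX : b ∉ X)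
    (hA : ∀ i, ¬ Cov G A X i → Out G A X i)
    (hB : ∀ i, ¬ Cov G B X i → Out G B X i) (h : ¬ Cov G (A ∪ B) X k) : Good G (A ∪ B) X k := by
  rcases Nat.eq_zero_or_pos k with rfl | hk
  · exact (val_singleton (mem_union_left _ haA) haX).good
  by_cases hc : Cov G A X (k - 1)
  · classical
    -- With i the least number of parts for A, the side A fails for i - 1 and B fails for k - i, and
    -- (i - 1) + (k - i) + 1 = k. Here i > 0 because a is not free.
    have hex : ∃ i, Cov G A X i := ⟨_, hc⟩
    obtain ⟨i, hi⟩ : ∃ i, Nat.find hex = i := ⟨_, rfl⟩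
    have hle : i ≤ k - 1 := hi ▸ Nat.find_min' hex hc
    have hci : Cov G A X i := hi ▸ Nat.find_spec hex
    have hi0 : i ≠ 0 := by
      rintro rfl
      obtain ⟨P, -, -, hP, hcard⟩ := hci
      obtain ⟨p, hp, -⟩ := hP a haA haX
      have := card_pos.2 ⟨p, hp⟩
      omega
    have hnA : ¬ Cov G A X (i - 1) := fun hc' => by
      have := Nat.find_min' hex hc'
      omega
    have hnB : ¬ Cov G B X (k - i) := fun hc' => h <|
      hci.add hc' hd subset_union_left subset_union_right (by omega) fun v hv hvX => by
        rcases mem_union.1 hv with h | h <;> simp [h, hvX]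
    rcases (hA _ hnA).cases with ⟨U, hU⟩ | ⟨l, hl, hU⟩
    · rcases (hB _ hnB).cases with ⟨U', hU'⟩ | ⟨l, hl, hU'⟩
      · exact (val_union hd ha hU hU' (by omega)).good
      · rw [union_comm]
        exact ((lowVertex_union_of_single hd.symm ha.symm haA haX hU').good (by omega))
    · exact ((lowVertex_union_of_single hd ha hb hbX hU).good (by omega))
  · have := good_union_of_single hd ha hb hbX (hA _ hc)
    rw [Nat.sub_add_cancel hk] at this
    exact this

theorem out_union {k : ℕ} (hA : ∀ i, ¬ Cov G A X i → Out G A X i)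
    (hB : ∀ i, ¬ Cov G B X i → Out G B X i) (h : ¬ Cov G (A ∪ B) X k) : Out G (A ∪ B) X k := by
  by_cases hBX : B ⊆ X
  · refine out_union_of_free hd ha (hA k fun hc => h (hc.extend subset_union_left le_rfl ?_))
    intro v hv hvX
    exact ⟨(mem_union.1 hv).resolve_right fun h => hvX (hBX h), hvX⟩
  by_cases hAX : A ⊆ X
  · rw [union_comm]
    refine out_union_of_free hd.symm ha.symm
      (hB k fun hc => h (hc.extend subset_union_right le_rfl ?_))
    intro v hv hvX
    exact ⟨(mem_union.1 hv).resolve_left fun h => hvX (hAX h), hvX⟩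
  obtain ⟨b, hb, hbX⟩ := not_subset.1 hBX
  obtain ⟨a, haA, haX⟩ := not_subset.1 hAX
  exact (good_union hd ha haA haX hb hbX hA hB h).out

end Disjoint

/-! ### Removing an end block -/

section Split

variable (hs : Split G H z A B)
include hs

/-- Removing an end block whose interior is 2-connected, leaving its cut vertex free. -/
theorem Split.val_insert {b : V} {k : ℕ} (hb : b ∈ B) (hbX : b ∉ X)
    (hU : Val G (insert z A) (insert z X) k U) : Val G H X (k + 1) (insert b U) := by
  obtain ⟨h1, h2, x, h3, h4⟩ := hU
  have hUA : ∀ u ∈ U, u ∈ A ∧ u ∉ X := fun u hu => by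
    have h5 := h1 u hu
    rw [mem_insert, mem_insert, not_or] at h5
    exact ⟨h5.1.resolve_left h5.2.1, h5.2.2⟩
  have hbU : b ∉ U := fun h => disjoint_left.1 hs.disj (hUA b h).1 hb
  refine ⟨?_, ?_, x, by rw [card_insert_of_notMem hbU]; omega, ?_⟩
  · intro u hu
    rcases mem_insert.1 hu with rfl | hu
    · exact ⟨hs.right_subset hb, hbX⟩
    · exact ⟨hs.left_subset (hUA u hu).1, (hUA u hu).2⟩
  · intro u hu v hv
    rcases mem_insert.1 hu with hu' | hu' <;> rcases mem_insert.1 hv with hv' | hv'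
    · rw [hu', hv']; exact G.loopless.irrefl _
    · rw [hu']; exact hs.symm.anti b hb v (hUA v hv').1
    · rw [hv']; exact hs.anti u (hUA u hu').1 b hb
    · exact h2 u hu' v hv'
  · have e1 : sumIn G H (insert b U) = dIn G H b + sumIn G H U := sum_insert hbU
    have e2 : sumIn G H U ≤ sumIn G (insert z A) U := sumIn_le_of_le fun u hu =>
      dIn_le_of_nbr fun v hv hadj => by
        rw [mem_insert]
        exact (hs.nbr (hUA u hu).1 hv hadj).symm
    have e3 := hs.symm.dIn_le hb
    have e4 := dIn_lt_card (G := G) hb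
    have e5 := hs.card
    rw [card_insert_of_notMem hs.notMem_left] at h4
    have e6 : (k + 1) * x = k * x + x := by ring
    omega

theorem Split.dIn_insert_sdiff (hu : u ∈ A) :
    dIn G (H \ X) u ≤ dIn G (insert z A \ insert z X) u + 1 :=
  dIn_le_of_nbr_insert (z := z) fun v hv hadj => by
    rw [mem_sdiff] at hv
    rcases hs.nbr hu hv.1 hadj with h | h
    · by_cases hvz : v = z
      · exact Or.inr hvz
      · left; simp [h, hv.2, hvz]
    · exact Or.inr h

theorem Split.dIn_insert_sdiff_of_not_adj (hu : u ∈ A) (hz : ¬ G.Adj u z) :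
    dIn G (H \ X) u ≤ dIn G (insert z A \ insert z X) u :=
  dIn_le_of_nbr fun v hv hadj => by
    rw [mem_sdiff] at hv
    have hvz : v ≠ z := by rintro rfl; exact hz hadj
    rcases hs.nbr hu hv.1 hadj with h | h
    · simp [h, hv.2, hvz]
    · exact absurd h hvz

/-- Since z is free, the old set avoids z and its degrees do not change, while b has degree at most
|B| in H. In a low pair at most one vertex is adjacent to the free vertex z; the other keeps its
degree and becomes low for the larger index. -/
theorem Split.good_of_peel {b : V} {k : ℕ} (hb : b ∈ B) (hbX : b ∉ X)
    (h : Out G (insert z A) (insert z X) k) : Good G H X (k + 1) := by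
  have hmem : ∀ {i U u}, Val G (insert z A) (insert z X) i U → u ∈ U → u ∈ A := by
    intro i U u hU hu
    have h5 := hU.1 u hu
    rw [mem_insert, mem_insert, not_or] at h5
    exact h5.1.resolve_left h5.2.1
  rcases h with (⟨U, hU⟩ | ⟨i, hi, U, u, hU, hu, hdeg⟩) |
    ⟨i, hi, U, U', u, u', hU, hU', hu, hu', -, hdeg, hdeg', hx⟩
  · exact (hs.val_insert hb hbX hU).good
  · refine LowVertex.good ⟨_, u, hs.val_insert hb hbX hU, mem_insert_of_mem hu, ?_⟩
      (by omega : i + 1 ≤ k + 1)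
    have := hs.dIn_insert_sdiff (X := X) (hmem hU hu)
    omega
  · by_cases hz : G.Adj u z
    · have hz' : ¬ G.Adj u' z := fun h' =>
        hx z (mem_insert_self _ _) (mem_insert_self _ _) ⟨hz, h'⟩
      refine LowVertex.good ⟨_, u', hs.val_insert hb hbX hU', mem_insert_of_mem hu', ?_⟩
        (by omega : i + 1 ≤ k + 1)
      exact (hs.dIn_insert_sdiff_of_not_adj (hmem hU' hu') hz').trans hdeg'
    · refine LowVertex.good ⟨_, u, hs.val_insert hb hbX hU, mem_insert_of_mem hu, ?_⟩
        (by omega : i + 1 ≤ k + 1)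
      exact (hs.dIn_insert_sdiff_of_not_adj (hmem hU hu) hz).trans hdeg

/-- A cover of z + A with z free would extend by one part: by the part for B if z is already used,
and by z + B otherwise. -/
theorem Split.not_cov_peel {k : ℕ} (hB : Cov G B X 1) (hT : TwoConn G (insert z B))
    (h : ¬ Cov G H X (k + 1)) : ¬ Cov G (insert z A) (insert z X) k := by
  intro hc
  rcases hc.of_insert_free hs.notMem_left with hc | hc
  · refine h (hc.add hB ?_ hs.insert_subset_left hs.right_subset le_rfl fun v hv hvX => ?_)
    · rw [disjoint_insert_left]; exact ⟨hs.notMem_right, hs.disj⟩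
    · rcases hs.mem_iff.1 hv with h1 | h1 | h1 <;> simp [h1, hvX]
      left; exact h1 ▸ hvX
  · refine h (hc.add (hT.cov (X := X)) ?_ hs.left_subset hs.symm.insert_subset_left le_rfl
      fun v hv hvX => ?_)
    · rw [disjoint_insert_right]; exact ⟨hs.notMem_left, hs.disj⟩
    · rcases hs.mem_iff.1 hv with h1 | h1 | h1 <;> simp [h1, hvX]
      right; exact h1 ▸ hvX

theorem Split.not_cov_left {k : ℕ} (hT : TwoConn G (insert z B))
    (h : ¬ Cov G H X (k + 1)) : ¬ Cov G A X k := by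
  intro hc
  refine h (hc.add (hT.cov (X := X)) ?_ hs.left_subset hs.symm.insert_subset_left le_rfl
    fun v hv hvX => ?_)
  · rw [disjoint_insert_right]; exact ⟨hs.notMem_left, hs.disj⟩
  · rcases hs.mem_iff.1 hv with h1 | h1 | h1 <;> simp [h1, hvX]
    right; exact h1 ▸ hvX

/-- The interior of the end block consists of free vertices. -/
theorem Split.out_of_free {k : ℕ} (hBX : B ⊆ X) (h : Out G (insert z A) X k) : Out G H X k := by
  refine h.lift hs.insert_subset_left (fun U hU => ?_) (fun u hu => ?_) ?_
  · have hc : #(insert z A) = #A + 1 := card_insert_of_notMem hs.notMem_left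
    have hle : ∀ u ∈ U, u ≠ z → dIn G H u ≤ dIn G (insert z A) u := fun u hu hne =>
      dIn_le_of_nbr fun v hv hadj => by
        rw [mem_insert]
        exact (hs.nbr ((mem_insert.1 (hU hu)).resolve_left hne) hv hadj).symm
    -- Only z can gain neighbours in B, at most |B| of them, and this is exactly the growth of the
    -- vertex set.
    have hz : dIn G H z ≤ dIn G (insert z A) z + #B := by
      unfold dIn
      rw [hs.eq, ← insert_union, filter_union]
      exact (card_union_le _ _).trans (Nat.add_le_add_left (card_filter_le _ _) _)
    have hH := hs.card
    by_cases hzU : z ∈ U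
    · have e1 : ∀ K, sumIn G K U = dIn G K z + sumIn G K (U.erase z) := fun K =>
        (add_sum_erase _ _ hzU).symm
      have e2 : sumIn G H (U.erase z) ≤ sumIn G (insert z A) (U.erase z) :=
        sumIn_le_of_le fun u hu => hle u (mem_of_mem_erase hu) (ne_of_mem_erase hu)
      rw [e1, e1]
      omega
    · have e2 : sumIn G H U ≤ sumIn G (insert z A) U :=
        sumIn_le_of_le fun u hu => hle u hu (by rintro rfl; exact hzU hu)
      omega
  · refine dIn_le_of_nbr fun v hv _ => ?_
    rw [mem_sdiff] at hv ⊢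
    refine ⟨?_, hv.2⟩
    rw [mem_insert]
    rcases hs.mem_iff.1 hv.1 with h1 | h1 | h1
    · exact Or.inl h1
    · exact Or.inr h1
    · exact absurd (hBX h1) hv.2
  · rintro u hu u' hu' hne x hx hxA ⟨h1, h2⟩
    have hxB : x ∈ B := by
      rw [mem_insert, not_or] at hxA
      rcases hs.mem_iff.1 hx with h | h | h <;> tauto
    have key : ∀ w ∈ insert z A, G.Adj w x → w = z := fun w hw hwx =>
      (mem_insert.1 hw).resolve_right fun hwA => hs.anti w hwA x hxB hwx
    exact hne ((key u hu h1).trans (key u' hu' h2).symm)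

theorem Split.not_cov_of_free {k : ℕ} (hBX : B ⊆ X) (h : ¬ Cov G H X k) :
    ¬ Cov G (insert z A) X k := by
  refine fun hc => h (hc.extend hs.insert_subset_left le_rfl fun v hv hvX => ⟨?_, hvX⟩)
  rw [mem_insert]
  rcases hs.mem_iff.1 hv with h1 | h1 | h1
  · exact Or.inl h1
  · exact Or.inr h1
  · exact absurd (hBX h1) hvX

end Split

/-! ### Base cases and the induction with free vertices -/

theorem lowVertex_singleton (hv : v ∉ X) : LowVertex G {v} X 0 := by
  refine ⟨{v}, v, val_singleton (mem_singleton_self v) hv, mem_singleton_self v, ?_⟩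
  have := dIn_lt_card (G := G) (mem_singleton_self v)
  have h2 := dIn_mono (G := G) (u := v) (sdiff_subset : {v} \ X ⊆ {v})
  rw [card_singleton] at this
  omega

theorem Split.lowVertex_single (hs : Split G H z A B) {b : V} (hb : b ∈ B) (hbX : b ∉ X)
    (h : LowVertex G A X 0) : LowVertex G H X 1 :=
  hs.lowVertex_union h (val_singleton hb hbX) (t := 0) le_rfl le_rfl rfl le_rfl

theorem Split.lowPair_single (hs : Split G H z A B) {b : V} (hb : b ∈ B) (hbX : b ∉ X)
    (h : LowPair G A X 0) : LowVertex G H X 1 ∨ LowPair G H X 1 :=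
  hs.lowPair_union h (val_singleton hb hbX) (t := 0) le_rfl rfl le_rfl

/-- A pendant vertex together with any non-free vertex of A gives a low vertex of index 1. If A is
entirely free, then only v and possibly z count, and the situation is that of K₁ or K₂. -/
theorem Split.out_of_pendant (hs : Split G H z A {v}) (hv : v ∉ X) {k : ℕ}
    (hk : 1 ≤ k) : Out G H X k := by
  by_cases hAX : A ⊆ X
  · have hvH : v ∈ H := hs.right_subset (mem_singleton_self v)
    have h0 : dIn G ({v} \ X) v ≤ 0 := by
      have h1 := dIn_lt_card (G := G) (mem_singleton_self v)
      have h2 := dIn_mono (G := G) (u := v) (sdiff_subset : {v} \ X ⊆ {v})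
      rw [card_singleton] at h1
      omega
    by_cases hz : z ∈ X
    · refine (LowVertex.good ⟨{v}, v, val_singleton hvH hv, mem_singleton_self v, ?_⟩
        (Nat.zero_le k)).out
      exact (hs.symm.dIn_sdiff_le_of_mem (mem_singleton_self v) hz).trans h0
    · have hzv : z ≠ v := fun h => hs.notMem_right (mem_singleton.2 h)
      refine Or.inr ⟨0, hk, {v}, {z}, v, z, val_singleton hvH hv,
        val_singleton hs.mem_center hz, mem_singleton_self v, mem_singleton_self z, hzv.symm,
        ?_, ?_, ?_⟩
      · have := hs.symm.dIn_sdiff_le (X := X) (mem_singleton_self v)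
        omega
      · refine (dIn_le_of_nbr_insert (A := ∅) (z := v) fun w hw hadj => ?_).trans
          (by simp [dIn])
        rw [mem_sdiff, hs.mem_iff, mem_singleton] at hw
        rcases hw.1 with h | h | h
        · subst h; exact absurd hadj (G.loopless.irrefl _)
        · exact absurd (hAX h) hw.2
        · exact Or.inr h
      · rintro x hx hxX ⟨h1, h2⟩
        rcases hs.mem_iff.1 hx with h | h | h
        · subst h; exact hz hxX
        · exact hs.symm.anti v (mem_singleton_self v) x h h1
        · rw [mem_singleton] at h; subst h; exact hv hxX
  · obtain ⟨a, ha, haX⟩ := not_subset.1 hAX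
    exact ((hs.symm.lowVertex_single ha haX (lowVertex_singleton hv)).good hk).out

/-- The main case combines indices k - 1 and 1 with a single extra spare vertex (t = 1). Low
outcomes of index 0 cannot be combined with index 1 in this way, since no k and t fit; they are
paired with a single vertex of the other side. -/
theorem Split.out_of_two_sides (hs : Split G H z A B) {a b : V} (ha : a ∈ A) (haX : a ∉ X)
    (hb : b ∈ B) (hbX : b ∉ X) {k : ℕ} (hk : 2 ≤ k) (hA : Out G A X (k - 1))
    (hB : Out G B X 1) : Out G H X k := by
  have low : ∀ {i}, i < k → (LowVertex G H X i ∨ LowPair G H X i) → Out G H X k := by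
    rintro i hi (h | h)
    · exact (h.good hi.le).out
    · exact Or.inr ⟨i, hi, h⟩
  have hB' : (∃ U, Val G B X 1 U) ∨ LowVertex G B X 0 ∨ LowPair G B X 0 := by
    rcases hB with (h | ⟨i, hi, h⟩) | ⟨i, hi, h⟩
    · exact Or.inl h
    · obtain rfl | rfl : i = 0 ∨ i = 1 := by omega
      · exact Or.inr (Or.inl h)
      · obtain ⟨U, _, hU, -⟩ := h
        exact Or.inl ⟨U, hU⟩
    · obtain rfl : i = 0 := by omega
      exact Or.inr (Or.inr h)
  rcases hB' with ⟨U', hU'⟩ | h | h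
  · rcases hA with (⟨U, hU⟩ | ⟨i, hi, h⟩) | ⟨i, hi, h⟩
    · exact (hs.val_union hU hU' (t := 1) (by omega) (by omega) (by omega) (by omega)).good.out
    · rcases Nat.eq_zero_or_pos i with rfl | hi0
      · exact ((hs.lowVertex_single hb hbX h).good (by omega)).out
      · exact ((hs.lowVertex_union h hU' (k := i + 1) (t := 1) (by omega) (by omega) (by omega)
          (by omega)).good (by omega)).out
    · rcases Nat.eq_zero_or_pos i with rfl | hi0
      · exact low (by omega) (hs.lowPair_single hb hbX h)
      · exact low (by omega) (hs.lowPair_union h hU' (t := 1) (by omega) (by omega) (by omega))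
  · exact ((hs.symm.lowVertex_single ha haX h).good (by omega)).out
  · exact low (by omega) (hs.symm.lowPair_single ha haX h)

/-- This is where low pairs originate: in K₂ with both ends non-free, each vertex has degree 1 and
belongs to a `Val` set of index 0 only. -/
theorem out_of_card_two (h : #H = 2) (hc : Conn G H) (hX : ¬ H ⊆ X) {k : ℕ} (hk : 1 ≤ k) :
    Out G H X k := by
  obtain ⟨u, u', hne, rfl⟩ := card_eq_two.1 h
  have hadj : ∀ u u', u ≠ u' → Conn G {u, u'} → G.Adj u u' := fun u u' hne hc => by
    obtain ⟨a, ha, b, hb, hab⟩ := hc.exists_adj (A := {u}) (B := {u'}) ⟨u, by simp⟩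
      ⟨u', by simp⟩ (by simpa using hne)
    rw [mem_singleton] at ha hb
    rwa [ha, hb] at hab
  have one : ∀ u u', u ∉ X → u' ∈ X → u ≠ u' → Out G {u, u'} X k := fun u u' hu hu' hne => by
    refine (LowVertex.good ⟨{u}, u, val_singleton (by simp) hu, by simp, ?_⟩ (Nat.zero_le k)).out
    refine (dIn_le_of_nbr (A := ∅) fun w hw hadj => ?_).trans (by simp [dIn])
    simp only [mem_sdiff, mem_insert, mem_singleton] at hw
    rcases hw.1 with h | h
    · subst h; exact absurd hadj (G.loopless.irrefl _)
    · subst h; exact absurd hu' hw.2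
  by_cases hu : u ∈ X
  · have hu' : u' ∉ X := fun hu' => hX (by
      intro w hw; simp only [mem_insert, mem_singleton] at hw
      rcases hw with rfl | rfl <;> assumption)
    rw [pair_comm]
    exact one u' u hu' hu hne.symm
  by_cases hu' : u' ∈ X
  · exact one u u' hu hu' hne
  · have hdeg : ∀ w ∈ ({u, u'} : Finset V), dIn G ({u, u'} \ X) w ≤ 0 + 1 := fun w hw => by
      have h1 := dIn_lt_card (G := G) hw
      have h2 := dIn_mono (G := G) (u := w) (sdiff_subset : {u, u'} \ X ⊆ {u, u'})
      omega
    refine Or.inr ⟨0, hk, {u}, {u'}, u, u', val_singleton (by simp) hu,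
      val_singleton (by simp) hu', by simp, by simp, hne, hdeg u (by simp), hdeg u' (by simp), ?_⟩
    rintro x hx hxX -
    simp only [mem_insert, mem_singleton] at hx
    rcases hx with rfl | rfl <;> contradiction

theorem out_of_card_one (h : #H = 1) (hX : ¬ H ⊆ X) {k : ℕ} : Out G H X k := by
  obtain ⟨u, rfl⟩ := card_eq_one.1 h
  rw [singleton_subset_iff] at hX
  exact ((lowVertex_singleton hX).good (Nat.zero_le k)).out

/-- If `H` cannot be covered by `k` disjoint 2-connected subgraphs, up to free vertices in `X`,
then it has many independent vertices of small degree sum or a suitable low vertex. -/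
theorem out_of_not_cov (n : ℕ) : ∀ (H X : Finset V) (k : ℕ), #H ≤ n → ¬ Cov G H X k →
    Out G H X k := by
  induction n with
  | zero =>
    intro H X k hn h
    exact absurd (cov_of_subset (by rw [card_eq_zero.1 (Nat.le_zero.1 hn)]; simp) k) h
  | succ n ih =>
    intro H X k hn h
    have hHX : ¬ H ⊆ X := fun hc => h (cov_of_subset hc k)
    rcases Nat.eq_zero_or_pos k with rfl | hk
    · obtain ⟨u, hu, huX⟩ := not_subset.1 hHX
      exact (val_singleton hu huX).good.out
    by_cases hc : Conn G H
    swap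
    · obtain ⟨A, B, hA, hB, hd, rfl, ha⟩ := not_conn_iff.1 hc
      rw [card_union_of_disjoint hd] at hn
      have := card_pos.2 hA
      have := card_pos.2 hB
      exact out_union hd ha (fun i => ih A X i (by omega)) (fun i => ih B X i (by omega)) h
    have hT : ¬ TwoConn G H := fun hT => h (hT.cov.mono hk)
    by_cases h3 : 3 ≤ #H
    swap
    · have h0 : #H ≠ 0 := fun h0 => hHX (by rw [card_eq_zero.1 h0]; simp)
      obtain h1 | h2 : #H = 1 ∨ #H = 2 := by omega
      · exact out_of_card_one h1 hHX
      · exact out_of_card_two h2 hc hHX hk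
    obtain ⟨z₀, A₀, B₀, hs₀, hA₀, hB₀⟩ := exists_split hc h3 hT
    obtain ⟨z, A, B, hs, hA, hB, -, hend⟩ := exists_endblock hc hs₀ hA₀ hB₀
    have hcard := hs.card
    have hA1 := card_pos.2 hA
    have hB1 := card_pos.2 hB
    have hzA : #(insert z A) = #A + 1 := card_insert_of_notMem hs.notMem_left
    by_cases hBX : B ⊆ X
    · exact hs.out_of_free hBX (ih _ _ _ (by omega) (hs.not_cov_of_free hBX h))
    obtain ⟨b, hb, hbX⟩ := not_subset.1 hBX
    rcases hend with ⟨v, rfl⟩ | hTB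
    · rw [mem_singleton] at hb
      subst hb
      exact hs.out_of_pendant hbX hk
    obtain ⟨k, rfl⟩ : ∃ l, k = l + 1 := ⟨k - 1, by omega⟩
    -- If one part suffices for B, the block can be removed at the cost of one part whether or not z
    -- is used elsewhere. Otherwise B is expensive as well, and z + B serves as one part.
    by_cases hB1' : Cov G B X 1
    · exact (hs.good_of_peel hb hbX (ih _ _ _ (by omega) (hs.not_cov_peel hB1' hTB h))).out
    have hnA := hs.not_cov_left hTB h
    obtain ⟨a, ha, haX⟩ := exists_mem_of_not_cov hnA
    rcases Nat.eq_zero_or_pos k with rfl | hk0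
    · exact (hs.val_union (val_singleton ha haX) (val_singleton hb hbX) (t := 0) le_rfl le_rfl rfl
        le_rfl).good.out
    · exact hs.out_of_two_sides ha haX hb hbX (by omega) (ih _ _ _ (by omega) hnA)
        (ih _ _ _ (by omega) hB1')

/-! ### Tracing low pairs when no vertex is free -/

variable (G) in
/-- `H` consists of two adjacent vertices. -/
def IsEdge (H : Finset V) : Prop := ∃ u u', G.Adj u u' ∧ H = {u, u'}

variable (G) in
/-- For some `z`, two adjacent vertices `u`, `u'` form a component of `H - z`,
which has a further vertex. -/
def EdgeBranch (H : Finset V) : Prop :=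
  ∃ z ∈ H, ∃ u ∈ H, ∃ u' ∈ H, ∃ s ∈ H, G.Adj u u' ∧ u ≠ z ∧ u' ≠ z ∧ s ≠ z ∧ s ≠ u ∧ s ≠ u' ∧
    (∀ v ∈ H, G.Adj u v → v = u' ∨ v = z) ∧ ∀ v ∈ H, G.Adj u' v → v = u ∨ v = z

variable (G) in
/-- `H - z` splits into two sides which are both as in `EdgeBranch`. -/
def TwoEdgeBranches (H : Finset V) : Prop :=
  ∃ z A B, Split G H z A B ∧ EdgeBranch G A ∧ EdgeBranch G B

/-- The vertices u and s witness index 1: u has degree at most 2, and s misses u, u' and itself, so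
the sum is at most |H| - 1. The same holds with u' in place of u. -/
theorem EdgeBranch.lowPair (h : EdgeBranch G H) : LowPair G H ∅ 1 := by
  obtain ⟨z, hz, u, hu, u', hu', s, hs, hadj, huz, huz', hsz, hsu, hsu', hnu, hnu'⟩ := h
  have key : ∀ u u', u ∈ H → u' ∈ H → G.Adj u u' → u ≠ z → u' ≠ z → s ≠ u → s ≠ u' →
      (∀ v ∈ H, G.Adj u v → v = u' ∨ v = z) → (∀ v ∈ H, G.Adj u' v → v = u ∨ v = z) →
      Val G H ∅ 1 {u, s} ∧ dIn G H u ≤ 2 := by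
    intro u u' hu hu' hadj huz huz' hsu hsu' hnu hnu'
    have hus : ¬ G.Adj u s := fun h => by
      rcases hnu s hs h with h | h
      · exact hsu' h
      · exact hsz h
    have hd : dIn G H u ≤ 2 := by
      refine (dIn_le_of_nbr (A := {u', z}) fun v hv hv' => ?_).trans (dIn_le_card.trans card_le_two)
      simpa using hnu v hv hv'
    refine ⟨⟨by simp [hu, hs], ?_, 0, card_pair (Ne.symm hsu), ?_⟩, hd⟩
    · intro a ha b hb
      simp only [mem_insert, mem_singleton] at ha hb
      rcases ha with rfl | rfl <;> rcases hb with rfl | rfl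
      · exact G.loopless.irrefl _
      · exact hus
      · exact fun h => hus h.symm
      · exact G.loopless.irrefl _
    · have h1 : sumIn G H {u, s} = dIn G H u + dIn G H s := sum_pair (Ne.symm hsu)
      have h2 : dIn G H s ≤ #(H \ {u, u', s}) := by
        refine (dIn_le_of_nbr fun v hv hadj' => ?_).trans dIn_le_card
        simp only [mem_sdiff, mem_insert, mem_singleton, not_or]
        refine ⟨hv, ?_, ?_, ?_⟩
        · rintro rfl; exact hus hadj'.symm
        · rintro rfl
          rcases hnu' s hs hadj'.symm with h | h
          · exact hsu h
          · exact hsz h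
        · rintro rfl; exact G.loopless.irrefl _ hadj'
      have h3 : #({u, u', s} : Finset V) = 3 := by
        rw [card_eq_three]
        exact ⟨u, u', s, hadj.ne, hsu.symm, hsu'.symm, rfl⟩
      have h4 : ({u, u', s} : Finset V) ⊆ H := by
        intro x hx; simp only [mem_insert, mem_singleton] at hx
        rcases hx with rfl | rfl | rfl <;> assumption
      rw [card_sdiff_of_subset h4, h3] at h2
      have := card_le_card h4
      omega
  obtain ⟨v1, d1⟩ := key u u' hu hu' hadj huz huz' hsu hsu' hnu hnu'
  obtain ⟨v2, d2⟩ := key u' u hu' hu hadj.symm huz' huz hsu' hsu hnu' hnu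
  exact ⟨_, _, u, u', v1, v2, by simp, by simp, hadj.ne, by simpa using d1, by simpa using d2,
    by simp⟩

theorem LowPair.exists_val {k : ℕ} (h : LowPair G H X k) : ∃ U, Val G H X k U := by
  obtain ⟨U, _, _, _, hU, -⟩ := h
  exact ⟨U, hU⟩

theorem LowVertex.exists_val {k : ℕ} (h : LowVertex G H X k) : ∃ U, Val G H X k U := by
  obtain ⟨U, _, hU, -⟩ := h
  exact ⟨U, hU⟩

theorem TwoEdgeBranches.low (h : TwoEdgeBranches G H) : LowVertex G H ∅ 2 ∨ LowPair G H ∅ 2 := by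
  obtain ⟨z, A, B, hs, hA, hB⟩ := h
  obtain ⟨U, hU⟩ := hB.lowPair.exists_val
  exact hs.lowPair_union hA.lowPair hU (t := 1) le_rfl rfl le_rfl

variable (G) in
/-- The outcome for `X = ∅`, where low pairs are traced back to explicit branches. -/
def SharpOut (H : Finset V) (k : ℕ) : Prop :=
  Good G H ∅ k ∨ 1 ≤ k ∧ IsEdge G H ∨ 2 ≤ k ∧ EdgeBranch G H ∨ 3 ≤ k ∧ TwoEdgeBranches G H

theorem Split.edgeBranch (hs : Split G H z A B) (hA : IsEdge G A) (hB : B.Nonempty) :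
    EdgeBranch G H := by
  obtain ⟨u, u', hadj, rfl⟩ := hA
  obtain ⟨s, hsB⟩ := hB
  have hz := hs.notMem_left
  have hd := disjoint_right.1 hs.disj hsB
  have hu : u ∈ ({u, u'} : Finset V) := by simp
  have hu' : u' ∈ ({u, u'} : Finset V) := by simp
  refine ⟨z, hs.mem_center, u, hs.left_subset hu, u', hs.left_subset hu', s, hs.right_subset hsB,
    hadj, ?_, ?_, ?_, ?_, ?_, ?_, ?_⟩
  · rintro rfl; exact hz hu
  · rintro rfl; exact hz hu'
  · rintro rfl; exact hs.notMem_right hsB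
  · rintro rfl; exact hd hu
  · rintro rfl; exact hd hu'
  · intro v hv hadj'
    rcases hs.nbr hu hv hadj' with h | h
    · simp only [mem_insert, mem_singleton] at h
      rcases h with rfl | h
      · exact absurd hadj' (G.loopless.irrefl _)
      · exact Or.inl h
    · exact Or.inr h
  · intro v hv hadj'
    rcases hs.nbr hu' hv hadj' with h | h
    · simp only [mem_insert, mem_singleton] at h
      rcases h with h | rfl
      · exact Or.inl h
      · exact absurd hadj' (G.loopless.irrefl _)
    · exact Or.inr h

theorem SharpOut.cases_one (h : SharpOut G H 1) :
    (∃ U, Val G H ∅ 1 U) ∨ LowVertex G H ∅ 0 ∨ IsEdge G H := by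
  rcases h with (h | ⟨i, hi, h⟩) | ⟨-, h⟩ | ⟨h, -⟩ | ⟨h, -⟩
  · exact Or.inl h
  · obtain rfl | rfl : i = 0 ∨ i = 1 := by omega
    · exact Or.inr (Or.inl h)
    · exact Or.inl h.exists_val
  · exact Or.inr (Or.inr h)
  · omega
  · omega

theorem SharpOut.cases_two (h : SharpOut G H 2) :
    (∃ U, Val G H ∅ 2 U) ∨ LowVertex G H ∅ 0 ∨ LowVertex G H ∅ 1 ∨ IsEdge G H ∨
      EdgeBranch G H := by
  rcases h with (h | ⟨i, hi, h⟩) | ⟨-, h⟩ | ⟨-, h⟩ | ⟨h, -⟩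
  · exact Or.inl h
  · obtain rfl | rfl | rfl : i = 0 ∨ i = 1 ∨ i = 2 := by omega
    · tauto
    · tauto
    · exact Or.inl h.exists_val
  · tauto
  · tauto
  · omega

theorem Split.sharpOut_two (hs : Split G H z A B) (hA : A.Nonempty) (hB : B.Nonempty)
    (hoA : SharpOut G A 1) (hoB : SharpOut G B 1) : SharpOut G H 2 := by
  obtain ⟨a, ha⟩ := hA
  obtain ⟨b, hb⟩ := hB
  rcases hoA.cases_one with ⟨U, hU⟩ | h | h
  · rcases hoB.cases_one with ⟨U', hU'⟩ | h | h
    · exact Or.inl (hs.val_union hU hU' (t := 1) le_rfl le_rfl rfl le_rfl).good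
    · exact Or.inl ((hs.symm.lowVertex_single ha (by simp) h).good (by norm_num))
    · exact Or.inr (Or.inr (Or.inl ⟨le_rfl, hs.symm.edgeBranch h ⟨a, ha⟩⟩))
  · exact Or.inl ((hs.lowVertex_single hb (by simp) h).good (by norm_num))
  · exact Or.inr (Or.inr (Or.inl ⟨le_rfl, hs.edgeBranch h ⟨b, hb⟩⟩))

/-- A side as in the second alternative determines the outcome. -/
theorem Split.sharpOut_or_val (hs : Split G H z A B) (hB : B.Nonempty) {k : ℕ}
    (hk : 3 ≤ k) (hoA : SharpOut G A 2) (hoB : SharpOut G B 2) :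
    SharpOut G H k ∨ (∃ U, Val G A ∅ 2 U) ∨ (LowVertex G B ∅ 0 ∨ IsEdge G B) := by
  obtain ⟨b, hb⟩ := hB
  rcases hoA.cases_two with h | h | h | h | h
  · exact Or.inr (Or.inl h)
  · exact Or.inl (Or.inl ((hs.lowVertex_single hb (by simp) h).good (by omega)))
  · rcases hoB.cases_two with ⟨U, hU⟩ | h' | h' | h' | h'
    · exact Or.inl (Or.inl ((hs.lowVertex_union h hU (k := 3) (t := 1) (by norm_num) le_rfl rfl
        le_rfl).good hk))
    · exact Or.inr (Or.inr (Or.inl h'))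
    · obtain ⟨U, hU⟩ := h'.exists_val
      exact Or.inl (Or.inl ((hs.lowVertex_union h hU (k := 2) (t := 1) le_rfl le_rfl rfl
        le_rfl).good (by omega)))
    · exact Or.inr (Or.inr (Or.inr h'))
    · obtain ⟨U, hU⟩ := h'.lowPair.exists_val
      exact Or.inl (Or.inl ((hs.lowVertex_union h hU (k := 2) (t := 1) le_rfl le_rfl rfl
        le_rfl).good (by omega)))
  · exact Or.inl (Or.inr (Or.inr (Or.inl ⟨by omega, hs.edgeBranch h ⟨b, hb⟩⟩)))
  · rcases hoB.cases_two with ⟨U, hU⟩ | h' | h' | h' | h'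
    · exact Or.inl (Or.inl ((hs.lowVertex_of_lowPair h.lowPair hU (k := 3) (t := 1) le_rfl le_rfl
        rfl le_rfl).good hk))
    · exact Or.inr (Or.inr (Or.inl h'))
    · obtain ⟨U, hU⟩ := h.lowPair.exists_val
      exact Or.inl (Or.inl ((hs.symm.lowVertex_union h' hU (k := 2) (t := 1) le_rfl le_rfl rfl
        le_rfl).good (by omega)))
    · exact Or.inr (Or.inr (Or.inr h'))
    · exact Or.inl (Or.inr (Or.inr (Or.inr ⟨hk, z, A, B, hs, h, h'⟩)))

/-- A `Val` set of index 2 in B has enough spare capacity to absorb every outcome of A: indices k -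
1 and 2 combine with t = 2, and low pairs of A become low vertices of H. If B has no such set, the
roles are exchanged and `Split.sharpOut_or_val` settles everything except trivial outcomes of A. -/
theorem Split.sharpOut_of_three_le (hs : Split G H z A B) (hA : A.Nonempty) (hB : B.Nonempty)
    {k : ℕ} (hk : 3 ≤ k) (hoA : SharpOut G A (k - 1)) (hoA2 : SharpOut G A 2)
    (hoB2 : SharpOut G B 2) : SharpOut G H k := by
  obtain ⟨a, ha⟩ := id hA
  obtain ⟨b, hb⟩ := id hB
  have easyA : LowVertex G A ∅ 0 ∨ IsEdge G A → SharpOut G H k := by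
    rintro (h | h)
    · exact Or.inl ((hs.lowVertex_single hb (by simp) h).good (by omega))
    · exact Or.inr (Or.inr (Or.inl ⟨by omega, hs.edgeBranch h hB⟩))
  have easyB : LowVertex G B ∅ 0 ∨ IsEdge G B → SharpOut G H k := by
    rintro (h | h)
    · exact Or.inl ((hs.symm.lowVertex_single ha (by simp) h).good (by omega))
    · exact Or.inr (Or.inr (Or.inl ⟨by omega, hs.symm.edgeBranch h hA⟩))
  rcases hs.symm.sharpOut_or_val hA hk hoB2 hoA2 with h | ⟨U', hU'⟩ | h
  · exact h
  · rcases hoA with (⟨U, hU⟩ | ⟨i, hi, h⟩) | ⟨-, h⟩ | ⟨-, h⟩ | ⟨h3, h⟩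
    · exact Or.inl (hs.val_union hU hU' (t := 2) (by omega) (by omega) (by omega)
        (by omega)).good
    · obtain rfl | rfl | hi2 : i = 0 ∨ i = 1 ∨ 2 ≤ i := by omega
      · exact easyA (Or.inl h)
      · exact Or.inl ((hs.lowVertex_union h hU' (k := 3) (t := 1) (by norm_num) le_rfl rfl
          le_rfl).good hk)
      · exact Or.inl ((hs.lowVertex_union h hU' (k := i + 1) (t := 2) le_rfl (by omega) (by omega)
          (by omega)).good (by omega))
    · exact easyA (Or.inr h)
    · exact Or.inl ((hs.lowVertex_of_lowPair h.lowPair hU' (k := 3) (t := 1) le_rfl le_rfl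
        rfl le_rfl).good hk)
    · rcases h.low with h | h
      · exact Or.inl ((hs.lowVertex_union h hU' (k := 3) (t := 2) le_rfl le_rfl rfl
          (by norm_num)).good hk)
      -- Index 4 is admissible because two edge branches in A already require k - 1 ≥ 3.
      · exact Or.inl ((hs.lowVertex_of_lowPair h hU' (k := 4) (t := 1) le_rfl (by norm_num) rfl
          le_rfl).good (by omega))
  · exact easyA h

/-- Two end blocks whose interiors need exactly two parts each. -/
theorem good_of_two_pairs {z' : V} {A' B' : Finset V} (hs : Split G H z A B)
    (hs' : Split G H z' A' B') (hBA : B' ⊆ A) (hB3 : 3 ≤ #B) (hBT : ¬ TwoConn G B)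
    (hB3' : 3 ≤ #B') (hBT' : ¬ TwoConn G B') {k : ℕ} (h : Out G (A \ B') {z'} k) :
    Good G H ∅ (k + 3) := by
  obtain ⟨b₁, hb₁, b₂, hb₂, hbne, hbadj, hbsum⟩ := exists_val_one hB3 hBT
  obtain ⟨c₁, hc₁, c₂, hc₂, hcne, hcadj, hcsum⟩ := exists_val_one hB3' hBT'
  have hbc : ∀ b ∈ B, ∀ c ∈ B', b ≠ c ∧ ¬ G.Adj b c := fun b hb c hc =>
    ⟨by rintro rfl; exact disjoint_left.1 hs.disj (hBA hc) hb, hs.symm.anti b hb c (hBA hc)⟩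
  have hRA' : ∀ u ∈ A \ B', u ≠ z' → u ∈ A' := fun u hu hne => by
    rw [mem_sdiff] at hu
    rcases hs'.mem_iff.1 (hs.left_subset hu.1) with h | h | h
    · exact absurd h hne
    · exact h
    · exact absurd h hu.2
  have hnbr : ∀ u ∈ A \ B', u ≠ z' → ∀ v ∈ H, G.Adj u v → v ∈ A \ B' ∨ v = z :=
    fun u hu hne v hv hadj => by
      rcases hs.nbr (mem_sdiff.1 hu).1 hv hadj with h | h
      · left
        exact mem_sdiff.2 ⟨h, fun hvB => hs'.anti u (hRA' u hu hne) v hvB hadj⟩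
      · exact Or.inr h
  -- A nonadjacent pair from each end block raises the index by 3 and adds one spare vertex. Each
  -- pair costs at most the size of its block interior plus 1; every u costs one for z.
  have key : ∀ {i U}, Val G (A \ B') {z'} i U →
      Val G H ∅ (i + 3) (U ∪ ({b₁, b₂} ∪ {c₁, c₂})) := by
    rintro i U ⟨h1, h2, x, h3, h4⟩
    have hUz : ∀ u ∈ U, u ∈ A \ B' ∧ u ≠ z' := fun u hu =>
      ⟨(h1 u hu).1, by simpa using (h1 u hu).2⟩
    have hUb : ∀ u ∈ U, ∀ b ∈ B, u ≠ b ∧ ¬ G.Adj u b := fun u hu b hb => by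
      have := (mem_sdiff.1 (hUz u hu).1).1
      exact ⟨by rintro rfl; exact disjoint_left.1 hs.disj this hb, hs.anti u this b hb⟩
    have hUc : ∀ u ∈ U, ∀ c ∈ B', u ≠ c ∧ ¬ G.Adj u c := fun u hu c hc =>
      ⟨by rintro rfl; exact (mem_sdiff.1 (hUz u hu).1).2 hc,
        hs'.anti u (hRA' u (hUz u hu).1 (hUz u hu).2) c hc⟩
    have hd2 : Disjoint ({b₁, b₂} : Finset V) {c₁, c₂} := by
      simp only [disjoint_insert_left, disjoint_singleton_left, mem_insert, mem_singleton, not_or]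
      exact ⟨⟨(hbc _ hb₁ _ hc₁).1, (hbc _ hb₁ _ hc₂).1⟩, (hbc _ hb₂ _ hc₁).1, (hbc _ hb₂ _ hc₂).1⟩
    have hd1 : Disjoint U ({b₁, b₂} ∪ {c₁, c₂}) := by
      rw [disjoint_left]
      intro u hu hu'
      simp only [mem_union, mem_insert, mem_singleton] at hu'
      rcases hu' with (h | h) | (h | h)
      · exact (hUb u hu _ hb₁).1 h
      · exact (hUb u hu _ hb₂).1 h
      · exact (hUc u hu _ hc₁).1 h
      · exact (hUc u hu _ hc₂).1 h
    refine ⟨?_, ?_, x + 1, ?_, ?_⟩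
    · intro u hu
      simp only [mem_union, mem_insert, mem_singleton] at hu
      refine ⟨?_, by simp⟩
      rcases hu with hu | (rfl | rfl) | (rfl | rfl)
      · exact hs.left_subset (mem_sdiff.1 (hUz u hu).1).1
      · exact hs.right_subset hb₁
      · exact hs.right_subset hb₂
      · exact hs'.right_subset hc₁
      · exact hs'.right_subset hc₂
    · have hb : ∀ b ∈ ({b₁, b₂} : Finset V), b ∈ B := by
        intro b hb; simp only [mem_insert, mem_singleton] at hb
        rcases hb with rfl | rfl <;> assumption
      have hc : ∀ c ∈ ({c₁, c₂} : Finset V), c ∈ B' := by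
        intro b hb; simp only [mem_insert, mem_singleton] at hb
        rcases hb with rfl | rfl <;> assumption
      have hbb : ∀ b ∈ ({b₁, b₂} : Finset V), ∀ b' ∈ ({b₁, b₂} : Finset V), ¬ G.Adj b b' := by
        intro b hb b' hb'; simp only [mem_insert, mem_singleton] at hb hb'
        rcases hb with rfl | rfl <;> rcases hb' with rfl | rfl
        exacts [G.loopless.irrefl _, hbadj, fun h => hbadj h.symm, G.loopless.irrefl _]
      have hcc : ∀ b ∈ ({c₁, c₂} : Finset V), ∀ b' ∈ ({c₁, c₂} : Finset V), ¬ G.Adj b b' := by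
        intro b hb b' hb'; simp only [mem_insert, mem_singleton] at hb hb'
        rcases hb with rfl | rfl <;> rcases hb' with rfl | rfl
        exacts [G.loopless.irrefl _, hcadj, fun h => hcadj h.symm, G.loopless.irrefl _]
      intro u hu v hv
      rw [mem_union, mem_union] at hu hv
      rcases hu with hu | hu | hu <;> rcases hv with hv | hv | hv
      · exact h2 u hu v hv
      · exact (hUb u hu v (hb v hv)).2
      · exact (hUc u hu v (hc v hv)).2
      · exact fun h => (hUb v hv u (hb u hu)).2 h.symm
      · exact hbb u hu v hv
      · exact (hbc u (hb u hu) v (hc v hv)).2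
      · exact fun h => (hUc v hv u (hc u hu)).2 h.symm
      · exact fun h => (hbc v (hb v hv) u (hc u hu)).2 h.symm
      · exact hcc u hu v hv
    · rw [card_union_of_disjoint hd1, card_union_of_disjoint hd2, card_pair hbne, card_pair hcne]
      omega
    · rw [sumIn_union hd1, sumIn_union hd2]
      have e0 : sumIn G H U ≤ sumIn G (A \ B') U + #U := sumIn_le_add_card fun u hu =>
        dIn_le_of_nbr_insert (hnbr u (hUz u hu).1 (hUz u hu).2)
      have e1 : sumIn G H {b₁, b₂} = dIn G H b₁ + dIn G H b₂ := sum_pair hbne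
      have e2 : sumIn G H {c₁, c₂} = dIn G H c₁ + dIn G H c₂ := sum_pair hcne
      have f1 := hs.symm.dIn_le hb₁
      have f2 := hs.symm.dIn_le hb₂
      have f3 := hs'.symm.dIn_le hc₁
      have f4 := hs'.symm.dIn_le hc₂
      have e3 := hs.card
      have e4 : #(A \ B') = #A - #B' := card_sdiff_of_subset hBA
      have e5 := card_le_card hBA
      have e6 : (i + 3) * (x + 1) = i * x + 3 * x + i + 3 := by ring
      omega
  -- Outside the remainder only z can be a neighbour, and z' was not counted because it was free.
  -- The gain of 2 fits the index increase of 3 even for a vertex of a low pair.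
  have hsd : ∀ u ∈ A \ B', u ≠ z' → dIn G (H \ ∅) u ≤ dIn G ((A \ B') \ {z'}) u + 2 :=
    fun u hu hne => by
      rw [sdiff_empty]
      have h1 : dIn G H u ≤ dIn G (A \ B') u + 1 := dIn_le_of_nbr_insert (hnbr u hu hne)
      have h2 : dIn G (A \ B') u ≤ dIn G ((A \ B') \ {z'}) u + 1 :=
        dIn_le_of_nbr_insert (z := z') fun v hv _ => by
          by_cases h : v = z'
          · exact Or.inr h
          · exact Or.inl (mem_sdiff.2 ⟨hv, by simpa using h⟩)
      omega
  have hne : ∀ {i U u}, Val G (A \ B') {z'} i U → u ∈ U → u ∈ A \ B' ∧ u ≠ z' :=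
    fun hU hu => ⟨(hU.1 _ hu).1, by simpa using (hU.1 _ hu).2⟩
  rcases h.cases with ⟨U, hU⟩ | ⟨i, hi, ⟨U, u, hU, hu, hdeg⟩ |
    ⟨U, _, u, _, hU, _, hu, _, _, hdeg, _⟩⟩
  · exact (key hU).good
  all_goals
    refine LowVertex.good ⟨_, u, key hU, mem_union_left _ hu, ?_⟩ (by omega : i + 3 ≤ k + 3)
    have := hsd u (hne hU hu).1 (hne hU hu).2
    omega

/-- A cover of the remainder with k parts, z' being free, would give one of A with k + 2: add the
two parts of B' if z' is used or lies outside A, and the single part z' + B' otherwise. Together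
with z + B this would cover H. -/
theorem not_cov_of_two_pairs {z' : V} {A' B' : Finset V} (hs : Split G H z A B)
    (hs' : Split G H z' A' B') (hBA : B' ⊆ A) (hT : TwoConn G (insert z B))
    (hT' : TwoConn G (insert z' B')) (hB2 : Cov G B' ∅ 2) {k : ℕ} (h : ¬ Cov G H ∅ (k + 3)) :
    ¬ Cov G (A \ B') {z'} k := by
  have hnA := hs.not_cov_left hT (k := k + 2) h
  intro hc
  by_cases hz : z' ∈ A
  · have hzR : z' ∈ A \ B' := mem_sdiff.2 ⟨hz, hs'.notMem_right⟩
    have hR : insert z' ((A \ B').erase z') = A \ B' := insert_erase hzR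
    have hc' : Cov G (insert z' ((A \ B').erase z')) (insert z' ∅) k := by
      rw [hR]; simpa using hc
    rcases hc'.of_insert_free (by simp) with hc' | hc'
    · rw [hR] at hc'
      refine hnA (hc'.add hB2 sdiff_disjoint sdiff_subset hBA le_rfl fun v hv _ => ?_)
      by_cases hvB : v ∈ B' <;> simp [hv, hvB]
    · refine hnA (hc'.add (hT'.cov (X := ∅)) ?_ ((erase_subset _ _).trans sdiff_subset)
        (insert_subset hz hBA) (by omega) fun v hv _ => ?_)
      · rw [disjoint_insert_right]
        exact ⟨by simp, disjoint_of_subset_left (erase_subset _ _) sdiff_disjoint⟩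
      · by_cases hvB : v ∈ B' <;> by_cases hvz : v = z' <;> simp [hv, hvB, hvz]
  · refine hnA (hc.add hB2 sdiff_disjoint sdiff_subset hBA le_rfl fun v hv _ => ?_)
    by_cases hvB : v ∈ B'
    · simp [hvB]
    · simp only [mem_sdiff, hv, hvB, mem_singleton]
      left
      exact ⟨⟨trivial, not_false⟩, by rintro rfl; exact hz hv⟩

/-- Disconnected sets, pendant vertices and end blocks whose interior needs one part all give
`Good`. If an interior needs more than two parts, both sides fail for two parts and the induction
hypothesis applies to both. The remaining case has two end blocks whose interiors need exactly two
parts each; they are removed together, and `out_of_not_cov` handles the rest. -/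
theorem sharpOut_of_not_cov (n : ℕ) : ∀ (H : Finset V) (k : ℕ), #H ≤ n → ¬ Cov G H ∅ k →
    SharpOut G H k := by
  induction n with
  | zero =>
    intro H k hn h
    exact absurd (cov_of_subset (by rw [card_eq_zero.1 (Nat.le_zero.1 hn)]) k) h
  | succ n ih =>
    intro H k hn h
    obtain ⟨u₀, hu₀, -⟩ := exists_mem_of_not_cov h
    rcases Nat.eq_zero_or_pos k with rfl | hk
    · exact Or.inl (val_singleton hu₀ (by simp)).good
    by_cases hc : Conn G H
    swap
    · obtain ⟨A, B, ⟨a, ha⟩, ⟨b, hb⟩, hd, rfl, hanti⟩ := not_conn_iff.1 hc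
      exact Or.inl (good_union hd hanti ha (by simp) hb (by simp)
        (fun i => out_of_not_cov _ A ∅ i le_rfl) (fun i => out_of_not_cov _ B ∅ i le_rfl) h)
    have hT : ¬ TwoConn G H := fun hT => h (hT.cov.mono hk)
    by_cases h3 : 3 ≤ #H
    swap
    · have h0 : #H ≠ 0 := fun h0 => by rw [card_eq_zero.1 h0] at hu₀; simp at hu₀
      obtain h1 | h2 : #H = 1 ∨ #H = 2 := by omega
      · obtain ⟨u, rfl⟩ := card_eq_one.1 h1
        exact Or.inl ((lowVertex_singleton (by simp)).good (Nat.zero_le k))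
      · obtain ⟨u, u', hne, rfl⟩ := card_eq_two.1 h2
        refine Or.inr (Or.inl ⟨hk, u, u', ?_, rfl⟩)
        obtain ⟨a, ha, b, hb, hab⟩ := hc.exists_adj (A := {u}) (B := {u'}) ⟨u, by simp⟩
          ⟨u', by simp⟩ (by simpa using hne)
        rw [mem_singleton] at ha hb
        rwa [ha, hb] at hab
    obtain ⟨k, rfl⟩ : ∃ l, k = l + 1 := ⟨k - 1, by omega⟩
    -- an end block whose interior is a single vertex or 2-connected
    have easy : ∀ {z A B}, Split G H z A B → A.Nonempty → B.Nonempty →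
        ((∃ v, B = {v}) ∨ TwoConn G (insert z B)) →
        SharpOut G H (k + 1) ∨ (TwoConn G (insert z B) ∧ ¬ Cov G B ∅ 1) := by
      intro z A B hs ⟨a, ha⟩ ⟨b, hb⟩ hend
      rcases hend with ⟨v, rfl⟩ | hTB
      · exact Or.inl (Or.inl ((hs.symm.lowVertex_single ha (by simp)
          (lowVertex_singleton (by simp))).good (by omega)))
      · by_cases hB1 : Cov G B ∅ 1
        · exact Or.inl (Or.inl (hs.good_of_peel hb (by simp)
            (out_of_not_cov _ _ _ _ le_rfl (hs.not_cov_peel hB1 hTB h))))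
        · exact Or.inr ⟨hTB, hB1⟩
    have hbig : ∀ {z A B}, Split G H z A B → A.Nonempty → B.Nonempty →
        TwoConn G (insert z B) → ¬ Cov G B ∅ 2 → 2 ≤ k → SharpOut G H (k + 1) := by
      intro z A B hs hA hB hTB hB2 hk2
      have hcard := hs.card
      have hA1 := card_pos.2 hA
      have hB1 := card_pos.2 hB
      have hnA := hs.not_cov_left hTB h
      exact hs.sharpOut_of_three_le hA hB (by omega) (ih A k (by omega) hnA)
        (ih A 2 (by omega) fun hc => hnA (hc.mono hk2)) (ih B 2 (by omega) hB2)
    obtain ⟨z₀, A₀, B₀, hs₀, hA₀, hB₀⟩ := exists_split hc h3 hT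
    obtain ⟨z, A, B, hs, hA, hB, -, hend⟩ := exists_endblock hc hs₀ hA₀ hB₀
    rcases easy hs hA hB hend with h1 | ⟨hTB, hB1⟩
    · exact h1
    have hcard := hs.card
    have hA1 := card_pos.2 hA
    have hBpos := card_pos.2 hB
    have hnA := hs.not_cov_left hTB h
    obtain rfl | rfl | hk2 : k = 0 ∨ k = 1 ∨ 2 ≤ k := by omega
    · obtain ⟨a, ha⟩ := hA
      obtain ⟨b, hb⟩ := hB
      exact Or.inl (hs.val_union (val_singleton ha (by simp)) (val_singleton hb (by simp)) (t := 0)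
        le_rfl le_rfl rfl le_rfl).good
    · exact hs.sharpOut_two hA hB (ih A 1 (by omega) hnA) (ih B 1 (by omega) hB1)
    by_cases hB2 : Cov G B ∅ 2
    swap
    · exact hbig hs hA hB hTB hB2 hk2
    -- A second end block is sought on the far side of z, so that its interior is disjoint from B.
    obtain ⟨z', A', B', hs', hA', hB', hBA, hend'⟩ := exists_endblock hc hs.symm hB hA
    rcases easy hs' hA' hB' hend' with h1 | ⟨hTB', hB1'⟩
    · exact h1
    by_cases hB2' : Cov G B' ∅ 2
    swap
    · exact hbig hs' hA' hB' hTB' hB2' hk2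
    -- A nonempty set covered by 2-connected parts contains one of them, hence at least three
    -- vertices.
    have hsize : ∀ {C : Finset V}, C.Nonempty → Cov G C ∅ 2 → 3 ≤ #C := by
      rintro C ⟨c, hc⟩ ⟨P, hP, -, hPc, -⟩
      obtain ⟨p, hp, -⟩ := hPc c hc (by simp)
      exact (hP p hp).1.1.trans (card_le_card (hP p hp).2)
    obtain ⟨k, rfl⟩ : ∃ l, k = l + 2 := ⟨k - 2, by omega⟩
    exact Or.inl (good_of_two_pairs hs hs' hBA (hsize hB hB2) (fun hT => hB1 hT.cov)
      (hsize hB' hB2') (fun hT => hB1' hT.cov)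
      (out_of_not_cov _ _ _ _ le_rfl (not_cov_of_two_pairs hs hs' hBA hTB hTB' hB2' h)))

end Covers

/-! ### Recognising the exceptional graphs -/

section Iso

variable {V W : Type*} {G : SimpleGraph V} {K : SimpleGraph W}

theorem nonempty_iso (f : W → V) (hf : f.Bijective)
    (h : ∀ x y, K.Adj x y ↔ G.Adj (f x) (f y)) : Nonempty (G ≃g K) :=
  ⟨(RelIso.symm ⟨Equiv.ofBijective f hf, fun {x y} => (h x y).symm⟩ : G ≃g K)⟩

theorem bijective_of_surjective [Fintype V] [Fintype W] (f : W → V) (hf : f.Surjective)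
    (hc : Fintype.card V = Fintype.card W) : f.Bijective :=
  (Fintype.bijective_iff_surjective_and_card f).2 ⟨hf, hc.symm⟩

theorem adj_iff_of_sum {α β : Type*} (K : SimpleGraph (α ⊕ β)) (f : α ⊕ β → V)
    (h₁ : ∀ i j, K.Adj (.inl i) (.inl j) ↔ G.Adj (f (.inl i)) (f (.inl j)))
    (h₂ : ∀ i j, K.Adj (.inl i) (.inr j) ↔ G.Adj (f (.inl i)) (f (.inr j)))
    (h₃ : ∀ i j, K.Adj (.inr i) (.inr j) ↔ G.Adj (f (.inr i)) (f (.inr j))) (x y : α ⊕ β) :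
    K.Adj x y ↔ G.Adj (f x) (f y) := by
  rcases x with i | i <;> rcases y with j | j
  · exact h₁ i j
  · exact h₂ i j
  · rw [K.adj_comm, G.adj_comm]; exact h₂ j i
  · exact h₃ i j

variable [Fintype V] [DecidableEq V]

theorem nonempty_iso_top_two {u u' : V} (hadj : G.Adj u u') (h : ∀ x, x = u ∨ x = u')
    (hc : Fintype.card V = 2) : Nonempty (G ≃g (⊤ : SimpleGraph (Fin 2))) := by
  refine nonempty_iso ![u, u'] (bijective_of_surjective _ (fun x => ?_) (by simpa using hc)) ?_
  · rcases h x with rfl | rfl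
    exacts [⟨0, rfl⟩, ⟨1, rfl⟩]
  · intro x y
    fin_cases x <;> fin_cases y <;> simp [hadj, hadj.symm]

theorem nonempty_iso_F5 {z u u' s s' : V} (hz : ∀ x ∈ ({u, u', s, s'} : Finset V), G.Adj z x)
    (hu : G.Adj u u') (hs : G.Adj s s')
    (hn : ∀ x ∈ ({u, u'} : Finset V), ∀ y ∈ ({s, s'} : Finset V), ¬ G.Adj x y)
    (h : ∀ x, x = z ∨ x ∈ ({u, u', s, s'} : Finset V)) (hc : Fintype.card V = 5) :
    Nonempty (G ≃g LightIndep.F5) := by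
  refine nonempty_iso (Sum.elim (fun _ => z) ![u, u', s, s'])
    (bijective_of_surjective _ (fun x => ?_) (by simpa using hc)) ?_
  · rcases h x with rfl | h
    · exact ⟨.inl (), rfl⟩
    · simp only [mem_insert, mem_singleton] at h
      rcases h with rfl | rfl | rfl | rfl
      exacts [⟨.inr 0, rfl⟩, ⟨.inr 1, rfl⟩, ⟨.inr 2, rfl⟩, ⟨.inr 3, rfl⟩]
  · have hz' := fun x hx => (hz x hx).symm
    have hn' : ∀ y ∈ ({s, s'} : Finset V), ∀ x ∈ ({u, u'} : Finset V), ¬ G.Adj y x :=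
      fun y hy x hx h => hn x hx y hy h.symm
    have hu' := hu.symm
    have hs' := hs.symm
    simp only [mem_insert, mem_singleton, forall_eq_or_imp, forall_eq] at hz hz' hn hn'
    rintro (i | i) (j | j) <;> fin_cases i <;> fin_cases j <;>
      simp [LightIndep.F5, hz, hz', hn, hn', hu, hs, hu', hs']

theorem F11_adj_inr {L : Set (Sym2 (Fin 3 ⊕ Fin 8))}
    (hL : L ⊆ {s(.inl 0, .inl 1), s(.inl 0, .inl 2)}) (i j : Fin 8) :
    (LightIndep.F11 L).Adj (.inr i) (.inr j) ↔
      (i = 0 ∧ j = 1 ∨ i = 1 ∧ j = 0) ∨ (i = 2 ∧ j = 3 ∨ i = 3 ∧ j = 2) ∨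
        (i = 4 ∧ j = 5 ∨ i = 5 ∧ j = 4) ∨ i = 6 ∧ j = 7 ∨ i = 7 ∧ j = 6 := by
  have h : s(Sum.inr i, Sum.inr j) ∉ L := fun h => by simpa using hL h
  simp only [LightIndep.F11, SimpleGraph.fromEdgeSet_adj, Set.mem_union, h]
  simp
  clear h
  revert i j
  decide

theorem F11_adj_inl_inr {L : Set (Sym2 (Fin 3 ⊕ Fin 8))}
    (hL : L ⊆ {s(.inl 0, .inl 1), s(.inl 0, .inl 2)}) (i : Fin 3) (j : Fin 8) :
    (LightIndep.F11 L).Adj (.inl i) (.inr j) ↔ (i = 0 ∨ j.val < 4 ∧ i = 1) ∨ 4 ≤ j.val ∧ i = 2 := by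
  have h : s(Sum.inl i, Sum.inr j) ∉ L := fun h => by simpa using hL h
  simp [LightIndep.F11, h]

theorem F12_adj_inr {L : Set (Sym2 (Fin 3 ⊕ Fin 9))}
    (hL : L ⊆ {s(.inl 0, .inl 1), s(.inl 0, .inl 2), s(.inl 0, .inr 8), s(.inl 2, .inr 8)})
    (i j : Fin 9) :
    (LightIndep.F12 L).Adj (.inr i) (.inr j) ↔
      (i = 0 ∧ j = 1 ∨ i = 1 ∧ j = 0) ∨ (i = 2 ∧ j = 3 ∨ i = 3 ∧ j = 2) ∨
        (i = 4 ∧ j = 5 ∨ i = 5 ∧ j = 4) ∨ (i = 6 ∧ j = 8 ∨ i = 8 ∧ j = 6) ∨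
        i = 7 ∧ j = 8 ∨ i = 8 ∧ j = 7 := by
  have h : s(Sum.inr i, Sum.inr j) ∉ L := fun h => by simpa using hL h
  simp only [LightIndep.F12, SimpleGraph.fromEdgeSet_adj, Set.mem_union, h]
  simp
  clear h
  revert i j
  decide

theorem F12_adj_inl_inr (L : Set (Sym2 (Fin 3 ⊕ Fin 9))) (i : Fin 3) (j : Fin 9) :
    (LightIndep.F12 L).Adj (.inl i) (.inr j) ↔
      ((j.val < 8 ∧ i = 0 ∨ j.val < 4 ∧ i = 1) ∨ 4 ≤ j.val ∧ j.val < 8 ∧ i = 2) ∨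
        s(.inl i, .inr j) ∈ L := by
  simp [LightIndep.F12, and_assoc]

theorem isInF11_of {z p q u u' s s' v v' t t' : V}
    (hz : ∀ x ∈ ({u, u', s, s', v, v', t, t'} : Finset V), G.Adj z x)
    (hp : ∀ x ∈ ({u, u', s, s'} : Finset V), G.Adj p x)
    (hq : ∀ x ∈ ({v, v', t, t'} : Finset V), G.Adj q x)
    (hu : G.Adj u u') (hs : G.Adj s s') (hv : G.Adj v v') (ht : G.Adj t t')
    (hn : ∀ x ∈ ({p, u, u', s, s'} : Finset V), ∀ y ∈ ({q, v, v', t, t'} : Finset V), ¬ G.Adj x y)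
    (hnu : ∀ x ∈ ({u, u'} : Finset V), ∀ y ∈ ({s, s'} : Finset V), ¬ G.Adj x y)
    (hnv : ∀ x ∈ ({v, v'} : Finset V), ∀ y ∈ ({t, t'} : Finset V), ¬ G.Adj x y)
    (h : ∀ x, x = z ∨ x ∈ ({p, u, u', s, s'} : Finset V) ∨ x ∈ ({q, v, v', t, t'} : Finset V))
    (hc : Fintype.card V = 11) : LightIndep.IsInF11 G := by
  have hL : {e : Sym2 (Fin 3 ⊕ Fin 8) | e = s(.inl 0, .inl 1) ∧ G.Adj z p ∨
      e = s(.inl 0, .inl 2) ∧ G.Adj z q} ⊆ {s(.inl 0, .inl 1), s(.inl 0, .inl 2)} := by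
    rintro e (⟨h, -⟩ | ⟨h, -⟩) <;> simp [h]
  refine ⟨_, hL, ?_⟩
  refine nonempty_iso (Sum.elim ![z, p, q] ![u, u', s, s', v, v', t, t'])
    (bijective_of_surjective _ (fun x => ?_) (by simpa using hc)) ?_
  · simp only [mem_insert, mem_singleton] at h
    rcases h x with rfl | (rfl | rfl | rfl | rfl | rfl) | (rfl | rfl | rfl | rfl | rfl)
    exacts [⟨.inl 0, rfl⟩, ⟨.inl 1, rfl⟩, ⟨.inr 0, rfl⟩, ⟨.inr 1, rfl⟩, ⟨.inr 2, rfl⟩,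
      ⟨.inr 3, rfl⟩, ⟨.inl 2, rfl⟩, ⟨.inr 4, rfl⟩, ⟨.inr 5, rfl⟩, ⟨.inr 6, rfl⟩, ⟨.inr 7, rfl⟩]
  · have hz' := fun x hx => (hz x hx).symm
    have hp' := fun x hx => (hp x hx).symm
    have hq' := fun x hx => (hq x hx).symm
    have hn' : ∀ y ∈ ({q, v, v', t, t'} : Finset V), ∀ x ∈ ({p, u, u', s, s'} : Finset V),
        ¬ G.Adj y x := fun y hy x hx h => hn x hx y hy h.symm
    have hnu' : ∀ y ∈ ({s, s'} : Finset V), ∀ x ∈ ({u, u'} : Finset V), ¬ G.Adj y x :=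
      fun y hy x hx h => hnu x hx y hy h.symm
    have hnv' : ∀ y ∈ ({t, t'} : Finset V), ∀ x ∈ ({v, v'} : Finset V), ¬ G.Adj y x :=
      fun y hy x hx h => hnv x hx y hy h.symm
    have hu' := hu.symm
    have hs' := hs.symm
    have hv' := hv.symm
    have ht' := ht.symm
    simp only [mem_insert, mem_singleton, forall_eq_or_imp, forall_eq] at hz hz' hp hp' hq hq'
    simp only [mem_insert, mem_singleton, forall_eq_or_imp, forall_eq] at hn hn' hnu hnu' hnv hnv'
    refine adj_iff_of_sum _ _ (fun i j => ?_) (fun i j => ?_) (fun i j => ?_)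
    · fin_cases i <;> fin_cases j <;>
        simp [LightIndep.F11, hn, hn', G.adj_comm p z, G.adj_comm q z]
    · rw [F11_adj_inl_inr hL]
      fin_cases i <;> fin_cases j <;> simp [hz, hp, hq, hn, hn']
    · rw [F11_adj_inr hL]
      fin_cases i <;> fin_cases j <;>
        simp [hn, hn', hnu, hnu', hnv, hnv', hu, hu', hs, hs', hv, hv', ht, ht']

theorem isInF12_of {z p q u u' s s' g v v' t t' : V}
    (hz : ∀ x ∈ ({u, u', s, s', v, v', t, t'} : Finset V), G.Adj z x)
    (hp : ∀ x ∈ ({u, u', s, s'} : Finset V), G.Adj p x)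
    (hq : ∀ x ∈ ({v, v', t, t'} : Finset V), G.Adj q x)
    (hu : G.Adj u u') (hs : ∀ x ∈ ({s, s'} : Finset V), G.Adj g x) (hv : G.Adj v v')
    (ht : G.Adj t t') (hss : ¬ G.Adj s s') (hg : G.Adj z g ∨ G.Adj p g)
    (hn : ∀ x ∈ ({p, u, u', s, s', g} : Finset V), ∀ y ∈ ({q, v, v', t, t'} : Finset V),
      ¬ G.Adj x y)
    (hnu : ∀ x ∈ ({u, u'} : Finset V), ∀ y ∈ ({s, s', g} : Finset V), ¬ G.Adj x y)
    (hnv : ∀ x ∈ ({v, v'} : Finset V), ∀ y ∈ ({t, t'} : Finset V), ¬ G.Adj x y)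
    (h : ∀ x, x = z ∨ x ∈ ({p, u, u', s, s', g} : Finset V) ∨ x ∈ ({q, v, v', t, t'} : Finset V))
    (hc : Fintype.card V = 12) : LightIndep.IsInF12 G := by
  -- The set L is read off from G. The side containing g plays the role of b₂, so p is b₂, q is b₁
  -- and g is c₉.
  have hL : {e : Sym2 (Fin 3 ⊕ Fin 9) | e = s(.inl 0, .inl 1) ∧ G.Adj z q ∨
      e = s(.inl 0, .inl 2) ∧ G.Adj z p ∨ e = s(.inl 0, .inr 8) ∧ G.Adj z g ∨
      e = s(.inl 2, .inr 8) ∧ G.Adj p g} ⊆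
      {s(.inl 0, .inl 1), s(.inl 0, .inl 2), s(.inl 0, .inr 8), s(.inl 2, .inr 8)} := by
    rintro e (⟨h, -⟩ | ⟨h, -⟩ | ⟨h, -⟩ | ⟨h, -⟩) <;> simp [h]
  refine ⟨_, hL, ?_, ?_⟩
  · rcases hg with hg | hg
    · exact ⟨s(.inl 0, .inr 8), by simp [hg], by simp⟩
    · exact ⟨s(.inl 2, .inr 8), by simp [hg], by simp⟩
  refine nonempty_iso (Sum.elim ![z, q, p] ![v, v', t, t', u, u', s, s', g])
    (bijective_of_surjective _ (fun x => ?_) (by simpa using hc)) ?_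
  · simp only [mem_insert, mem_singleton] at h
    rcases h x with rfl | (rfl | rfl | rfl | rfl | rfl | rfl) | (rfl | rfl | rfl | rfl | rfl)
    exacts [⟨.inl 0, rfl⟩, ⟨.inl 2, rfl⟩, ⟨.inr 4, rfl⟩, ⟨.inr 5, rfl⟩, ⟨.inr 6, rfl⟩,
      ⟨.inr 7, rfl⟩, ⟨.inr 8, rfl⟩, ⟨.inl 1, rfl⟩, ⟨.inr 0, rfl⟩, ⟨.inr 1, rfl⟩, ⟨.inr 2, rfl⟩,
      ⟨.inr 3, rfl⟩]
  · have hs' := fun x hx => (hs x hx).symm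
    have hn' : ∀ y ∈ ({q, v, v', t, t'} : Finset V), ∀ x ∈ ({p, u, u', s, s', g} : Finset V),
        ¬ G.Adj y x := fun y hy x hx h => hn x hx y hy h.symm
    have hnu' : ∀ y ∈ ({s, s', g} : Finset V), ∀ x ∈ ({u, u'} : Finset V), ¬ G.Adj y x :=
      fun y hy x hx h => hnu x hx y hy h.symm
    have hnv' : ∀ y ∈ ({t, t'} : Finset V), ∀ x ∈ ({v, v'} : Finset V), ¬ G.Adj y x :=
      fun y hy x hx h => hnv x hx y hy h.symm
    have hu' := hu.symm
    have hv' := hv.symm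
    have ht' := ht.symm
    have hss' : ¬ G.Adj s' s := fun h => hss h.symm
    simp only [mem_insert, mem_singleton, forall_eq_or_imp, forall_eq] at hz hp hq hs hs'
    simp only [mem_insert, mem_singleton, forall_eq_or_imp, forall_eq] at hn hn' hnu hnu' hnv hnv'
    refine adj_iff_of_sum _ _ (fun i j => ?_) (fun i j => ?_) (fun i j => ?_)
    · fin_cases i <;> fin_cases j <;>
        simp [LightIndep.F12, hn, hn', G.adj_comm p z, G.adj_comm q z]
    · rw [F12_adj_inl_inr]
      fin_cases i <;> fin_cases j <;> simp [hz, hp, hq, hn, hn']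
    · rw [F12_adj_inr hL]
      fin_cases i <;> fin_cases j <;>
        simp [hn, hn', hnu, hnu', hnv, hnv', hu, hu', hs, hs', hv, hv', ht, ht', hss, hss']

set_option maxHeartbeats 800000 in
theorem nonempty_iso_H {z b u u' : V} {A B : Finset V} {a k : ℕ} (ha : #A = a) (hk : #B = k)
    (hz : ∀ x ∈ A ∪ B, G.Adj z x) (hb : ∀ x ∈ A ∪ B, G.Adj b x) (hu : G.Adj u u')
    (hzu : G.Adj z u) (hzu' : G.Adj z u')
    (hA : ∀ x ∈ A, ∀ y ∈ A, x ≠ y → G.Adj x y) (hB : ∀ x ∈ B, ∀ y ∈ B, x ≠ y → G.Adj x y)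
    (hn : ∀ x ∈ A, ∀ y ∈ B, ¬ G.Adj x y)
    (hnu : ∀ x ∈ ({u, u'} : Finset V), ∀ y, y = b ∨ y ∈ A ∪ B → ¬ G.Adj x y)
    (h : ∀ x, x = z ∨ x = b ∨ x = u ∨ x = u' ∨ x ∈ A ∨ x ∈ B)
    (hc : Fintype.card V = a + k + 4) :
    Nonempty (G ≃g LightIndep.H (a + 1) (k + 1)) ∨
      Nonempty (G ≃g LightIndep.HMinus (a + 1) (k + 1)) := by
  let eA : Fin (a + 1 - 1) ≃ A := (A.equivFinOfCardEq ha).symm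
  let eB : Fin (k + 1 - 1) ≃ B := (B.equivFinOfCardEq hk).symm
  let f : Fin 4 ⊕ (Fin (a + 1 - 1) ⊕ Fin (k + 1 - 1)) → V :=
    Sum.elim ![z, b, u, u'] (Sum.elim (fun i => eA i) (fun i => eB i))
  have hf : f.Bijective := by
    refine bijective_of_surjective _ (fun x => ?_) (by simp [hc]; omega)
    rcases h x with rfl | rfl | rfl | rfl | hx | hx
    · exact ⟨.inl 0, rfl⟩
    · exact ⟨.inl 1, rfl⟩
    · exact ⟨.inl 2, rfl⟩
    · exact ⟨.inl 3, rfl⟩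
    · exact ⟨.inr (.inl (eA.symm ⟨x, hx⟩)), by simp [f]⟩
    · exact ⟨.inr (.inr (eB.symm ⟨x, hx⟩)), by simp [f]⟩
  have hzA : ∀ i, G.Adj z (eA i) := fun i => hz _ (mem_union_left _ (eA i).2)
  have hzB : ∀ i, G.Adj z (eB i) := fun i => hz _ (mem_union_right _ (eB i).2)
  have hbA : ∀ i, G.Adj b (eA i) := fun i => hb _ (mem_union_left _ (eA i).2)
  have hbB : ∀ i, G.Adj b (eB i) := fun i => hb _ (mem_union_right _ (eB i).2)
  have huA : ∀ i, ¬ G.Adj u (eA i) := fun i =>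
    hnu u (by simp) _ (Or.inr (mem_union_left _ (eA i).2))
  have huB : ∀ i, ¬ G.Adj u (eB i) := fun i =>
    hnu u (by simp) _ (Or.inr (mem_union_right _ (eB i).2))
  have huA' : ∀ i, ¬ G.Adj u' (eA i) := fun i =>
    hnu u' (by simp) _ (Or.inr (mem_union_left _ (eA i).2))
  have huB' : ∀ i, ¬ G.Adj u' (eB i) := fun i =>
    hnu u' (by simp) _ (Or.inr (mem_union_right _ (eB i).2))
  have hub : ¬ G.Adj u b := hnu u (by simp) b (Or.inl rfl)
  have hub' : ¬ G.Adj u' b := hnu u' (by simp) b (Or.inl rfl)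
  have hbu : ¬ G.Adj b u := fun h => hub h.symm
  have hbu' : ¬ G.Adj b u' := fun h => hub' h.symm
  have hAA : ∀ i j, G.Adj (eA i : V) (eA j) ↔ i ≠ j := fun i j =>
    ⟨fun h e => h.ne (by rw [e]), fun h => hA _ (eA i).2 _ (eA j).2 fun e =>
      h (eA.injective (Subtype.ext e))⟩
  have hBB : ∀ i j, G.Adj (eB i : V) (eB j) ↔ i ≠ j := fun i j =>
    ⟨fun h e => h.ne (by rw [e]), fun h => hB _ (eB i).2 _ (eB j).2 fun e =>
      h (eB.injective (Subtype.ext e))⟩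
  have hAB : ∀ i j, ¬ G.Adj (eA i : V) (eB j) := fun i j => hn _ (eA i).2 _ (eB j).2
  have hu' := hu.symm
  have hzu2 := hzu.symm
  have hzu2' := hzu'.symm
  -- The edge ab is the only undetermined adjacency; it decides between the two graphs.
  by_cases hzb : G.Adj z b
  · left
    refine nonempty_iso f hf (adj_iff_of_sum _ _ (fun i j => ?_) (fun i j => ?_)
      (adj_iff_of_sum ((LightIndep.H (a + 1) (k + 1)).comap Sum.inr) (f ∘ Sum.inr)
        (fun i j => ?_) (fun i j => ?_) (fun i j => ?_)))
    · have hbz := hzb.symm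
      fin_cases i <;> fin_cases j <;>
        simp [LightIndep.H, f, hzb, hbz, hu, hu', hzu, hzu2, hzu', hzu2', hub, hub', hbu, hbu']
    · rcases j with j | j <;> fin_cases i <;>
        simp [LightIndep.H, f, hzA, hzB, hbA, hbB, huA, huB, huA', huB']
    · simp [LightIndep.H, f, hAA]; exact fun h => ⟨i, j, h, Or.inl ⟨rfl, rfl⟩⟩
    · simp [LightIndep.H, f, hAB]
    · simp [LightIndep.H, f, hBB]; exact fun h => ⟨i, j, h, Or.inl ⟨rfl, rfl⟩⟩
  · right
    refine nonempty_iso f hf (adj_iff_of_sum _ _ (fun i j => ?_) (fun i j => ?_)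
      (adj_iff_of_sum ((LightIndep.HMinus (a + 1) (k + 1)).comap Sum.inr) (f ∘ Sum.inr)
        (fun i j => ?_) (fun i j => ?_) (fun i j => ?_)))
    · have hbz : ¬ G.Adj b z := fun h => hzb h.symm
      fin_cases i <;> fin_cases j <;> simp [LightIndep.HMinus, LightIndep.H, f, hzb, hbz, hu, hu',
        hzu, hzu2, hzu', hzu2', hub, hub', hbu, hbu']
    · rcases j with j | j <;> fin_cases i <;>
        simp [LightIndep.HMinus, LightIndep.H, f, hzA, hzB, hbA, hbB, huA, huB, huA', huB']
    · simp [LightIndep.HMinus, LightIndep.H, f, hAA]; exact fun h => ⟨i, j, h, Or.inl ⟨rfl, rfl⟩⟩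
    · simp [LightIndep.HMinus, LightIndep.H, f, hAB]
    · simp [LightIndep.HMinus, LightIndep.H, f, hBB]; exact fun h => ⟨i, j, h, Or.inl ⟨rfl, rfl⟩⟩

end Iso

/-! ### From the degree conditions to the exceptional graphs -/

/-! ### From covers by 2-connected sets to proper partitions -/

section Partition

variable {V W : Type*} [DecidableEq V] {G : SimpleGraph V} {K : SimpleGraph W}

/-- The images of the vertices reachable from x and of the remaining ones would form a separation of
Q. -/
theorem Conn.connected [Nonempty W] {Q : Finset V} (h : Conn G Q) (f : W → V)
    (hf : ∀ a b, G.Adj (f a) (f b) → K.Adj a b) (hfi : f.Injective)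
    (hQ : ∀ v, v ∈ Q ↔ ∃ w, f w = v) : K.Connected := by
  classical
  refine ⟨fun x y => ?_⟩
  by_contra hxy
  refine h {v ∈ Q | ∃ w, f w = v ∧ K.Reachable x w} {v ∈ Q | ¬ ∃ w, f w = v ∧ K.Reachable x w}
    ⟨f x, ?_⟩ ⟨f y, ?_⟩ (disjoint_filter_filter_not _ _ _) (filter_union_filter_not_eq _ _) ?_
  · exact mem_filter.2 ⟨(hQ _).2 ⟨x, rfl⟩, x, rfl, SimpleGraph.Reachable.refl _⟩
  · refine mem_filter.2 ⟨(hQ _).2 ⟨y, rfl⟩, ?_⟩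
    rintro ⟨w, hw, hr⟩
    exact hxy (hfi hw ▸ hr)
  · intro a ha b hb hab
    obtain ⟨-, w, rfl, hr⟩ := mem_filter.1 ha
    obtain ⟨hbQ, hb⟩ := mem_filter.1 hb
    obtain ⟨w', rfl⟩ := (hQ _).1 hbQ
    exact hb ⟨w', rfl, hr.trans (hf _ _ hab).reachable⟩

theorem TwoConn.isKConnected {p : Finset V} (h : TwoConn G p) :
    LightIndep.IsKConnected 2 (G.induce (p : Set V)) := by
  obtain ⟨h3, hc, hz⟩ := h
  refine ⟨by simpa using Nat.lt_of_succ_le h3, fun S hS => ?_⟩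
  have hQ : Conn G (p \ S.image Subtype.val) := by
    rcases Nat.lt_or_ge #S 1 with h0 | h1
    · have : S = ∅ := card_eq_zero.1 (by omega)
      subst this
      simpa using hc
    · obtain ⟨z, rfl⟩ := card_eq_one.1 (by omega : #S = 1)
      rw [image_singleton, sdiff_singleton_eq_erase]
      exact hz z (mem_coe.1 z.2)
  have hmem : ∀ v, v ∈ p \ S.image Subtype.val ↔
      ∃ w : ((S : Set (p : Set V))ᶜ : Set (p : Set V)), (w : V) = v := by
    intro v
    simp only [mem_sdiff, mem_image, not_exists, not_and]
    constructor
    · rintro ⟨h1, h2⟩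
      exact ⟨⟨⟨v, h1⟩, fun h => h2 _ h rfl⟩, rfl⟩
    · rintro ⟨w, rfl⟩
      refine ⟨w.1.2, fun y hy he => w.2 ?_⟩
      rwa [Subtype.ext he] at hy
  have hne : (p \ S.image Subtype.val).Nonempty := by
    rw [← card_pos]
    have h1 := le_card_sdiff (S.image Subtype.val) p
    have h2 : #(S.image Subtype.val) ≤ #S := card_image_le
    omega
  obtain ⟨v, hv⟩ := hne
  obtain ⟨w, -⟩ := (hmem v).1 hv
  have : Nonempty ((S : Set (p : Set V))ᶜ : Set (p : Set V)) := ⟨w⟩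
  exact hQ.connected (fun w => (w : V)) (fun a b h => h)
    (fun a b h => Subtype.ext (Subtype.ext h)) hmem

theorem Cov.exists_finpartition [Fintype V] [DecidableRel G.Adj] {m : ℕ} (h : Cov G univ ∅ m) :
    ∃ P : Finpartition (univ : Finset V), LightIndep.IsKProper G 2 P ∧ #P.parts ≤ m := by
  obtain ⟨P, hP, hd, hc, hm⟩ := h
  refine ⟨⟨P, Finset.supIndep_iff_pairwiseDisjoint.2 hd, ?_, fun h => ?_⟩,
    fun p hp => (hP p hp).1.isKConnected, hm⟩
  · refine eq_univ_of_forall fun v => ?_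
    obtain ⟨p, hp, hv⟩ := hc v (mem_univ v) (notMem_empty v)
    exact mem_sup.2 ⟨p, hp, hv⟩
  · simpa using (hP _ h).1.nonempty

end Partition

/-! ### Weights of independent sets and the bound α*² < n -/

section Weights

variable {V : Type*} [Fintype V] [DecidableEq V] {G : SimpleGraph V} [DecidableRel G.Adj]

variable (G) in
/-- Every large independent set has degree sum at least `|V|`. -/
def LargeHeavy : Prop :=
  ∀ I : Finset V, (∀ u ∈ I, ∀ v ∈ I, ¬ G.Adj u v) → ∀ u ∈ I, dIn G univ u + 1 ≤ #I →
    Fintype.card V ≤ sumIn G univ I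

theorem dIn_univ (u : V) : dIn G univ u = G.degree u := by
  rw [dIn, ← G.card_neighborFinset_eq_degree, G.neighborFinset_eq_filter]

theorem degSum_eq (I : Finset V) : LightIndep.degSum G I = sumIn G univ I :=
  sum_congr rfl fun u _ => (dIn_univ u).symm

theorem isIndepSet_iff (I : Finset V) :
    G.IsIndepSet (I : Set V) ↔ ∀ u ∈ I, ∀ v ∈ I, ¬ G.Adj u v :=
  ⟨fun h _ hu _ hv hadj => h hu hv hadj.ne hadj, fun h _ hu _ hv _ => h _ hu _ hv⟩

theorem largeHeavy_of_le_sigmaStar (h : (Fintype.card V : ℕ∞) ≤ LightIndep.sigmaStar G) :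
    LargeHeavy G := by
  intro I hI u hu hd
  have hl : LightIndep.IsLarge G I := by
    have h1 : LightIndep.minDegOn G I ≤ (G.degree u : ℕ∞) := Finset.inf_le hu
    refine (add_le_add_left h1 1).trans ?_
    rw [dIn_univ] at hd
    exact_mod_cast hd
  have h1 : LightIndep.sigmaStar G ≤ (LightIndep.degSum G I : ℕ∞) :=
    iInf_le_of_le I (iInf_le_of_le ((isIndepSet_iff I).2 hI) (iInf_le _ hl))
  rw [← degSum_eq]
  exact_mod_cast h.trans h1

variable (G) in
theorem alphaStar_eq : LightIndep.alphaStar G = ({I | (∀ u ∈ I, ∀ v ∈ I, ¬ G.Adj u v) ∧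
    sumIn G univ I + 1 ≤ Fintype.card V} : Finset (Finset V)).sup Finset.card := by
  unfold LightIndep.alphaStar
  congr 1
  ext I
  simp only [mem_filter, isIndepSet_iff, LightIndep.IsLight, degSum_eq]

theorem card_le_alphaStar {I : Finset V} (hI : ∀ u ∈ I, ∀ v ∈ I, ¬ G.Adj u v)
    (h : sumIn G univ I + 1 ≤ Fintype.card V) : #I ≤ LightIndep.alphaStar G := by
  rw [alphaStar_eq]
  exact Finset.le_sup (f := Finset.card) (mem_filter.2 ⟨mem_univ _, hI, h⟩)

theorem exists_card_eq_alphaStar [Nonempty V] : ∃ I : Finset V,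
    (∀ u ∈ I, ∀ v ∈ I, ¬ G.Adj u v) ∧ sumIn G univ I + 1 ≤ Fintype.card V ∧
      #I = LightIndep.alphaStar G := by
  rw [alphaStar_eq]
  have hne : ({I | (∀ u ∈ I, ∀ v ∈ I, ¬ G.Adj u v) ∧
      sumIn G univ I + 1 ≤ Fintype.card V} : Finset (Finset V)).Nonempty :=
    ⟨∅, mem_filter.2 ⟨mem_univ _, by simp, Fintype.card_pos (α := V)⟩⟩
  obtain ⟨I, hI, he⟩ := exists_mem_eq_sup _ hne Finset.card
  obtain ⟨-, h1, h2⟩ := mem_filter.1 hI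
  exact ⟨I, h1, h2, he.symm⟩

theorem one_le_alphaStar [Nonempty V] : 1 ≤ LightIndep.alphaStar G := by
  obtain ⟨v⟩ := ‹Nonempty V›
  have := card_le_alphaStar (G := G) (I := {v}) (by simp)
    (by rw [sumIn_singleton]; exact dIn_lt_card (mem_univ v))
  simpa using this

/-- A maximum light set is too light to be large, so each of its vertices has degree at least its
size. -/
theorem alphaStar_sq_lt_card [Nonempty V] (h : LargeHeavy G) :
    LightIndep.alphaStar G * LightIndep.alphaStar G + 1 ≤ Fintype.card V := by
  obtain ⟨I, hI, hs, hc⟩ := exists_card_eq_alphaStar (G := G)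
  rw [← hc]
  have hd : ∀ u ∈ I, #I ≤ dIn G univ u := by
    intro u hu
    by_contra hlt
    have := h I hI u hu (by omega)
    omega
  have h1 : #I * #I ≤ sumIn G univ I := by
    rw [← smul_eq_mul]
    exact card_nsmul_le_sum _ _ _ hd
  omega

/-- A set of small degree sum contains a smaller set whose free vertices have small degree. -/
theorem exists_low_subset {U F : Finset V} {k x : ℕ} (hU : #U = k + 1 + x)
    (hs : sumIn G univ U + 1 ≤ Fintype.card V + k * x) (hF : F ⊆ U) (hFk : #F ≤ k + 1)
    (h : ∀ I, F ⊆ I → I ⊆ U → #I = k + 1 → Fintype.card V ≤ sumIn G univ I) :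
    ∃ I, F ⊆ I ∧ I ⊆ U ∧ #I = k + 1 ∧ ∀ w ∈ I, w ∉ F → dIn G univ w + 1 ≤ k := by
  let T := (U.powersetCard (k + 1)).filter (F ⊆ ·)
  have hT : ∀ I, I ∈ T ↔ (I ⊆ U ∧ #I = k + 1) ∧ F ⊆ I := fun I => by
    simp only [T, mem_filter, mem_powersetCard]
  obtain ⟨I₀, h1, h2, h3⟩ := exists_subsuperset_card_eq hF hFk (by omega : k + 1 ≤ #U)
  -- Let I have least degree sum. If some w in I \ F had degree at least k, exchanging w would show
  -- that all x vertices of U \ I have degree at least k. These use up kx, leaving I a sum below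
  -- |V|.
  obtain ⟨I, hI, hmin⟩ := exists_min_image T (fun I => sumIn G univ I) ⟨I₀, (hT _).2 ⟨⟨h2, h3⟩, h1⟩⟩
  obtain ⟨⟨hIU, hIc⟩, hFI⟩ := (hT I).1 hI
  refine ⟨I, hFI, hIU, hIc, fun w hw hwF => ?_⟩
  by_contra hlt
  have hout : ∀ v ∈ U \ I, k ≤ dIn G univ v := by
    intro v hv
    obtain ⟨hvU, hvI⟩ := mem_sdiff.1 hv
    have hvI' : v ∉ I.erase w := fun h => hvI (mem_of_mem_erase h)
    have hmem : insert v (I.erase w) ∈ T := by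
      refine (hT _).2 ⟨⟨insert_subset hvU ((erase_subset _ _).trans hIU), ?_⟩, ?_⟩
      · rw [card_insert_of_notMem hvI', card_erase_add_one hw, hIc]
      · intro y hy
        exact mem_insert_of_mem (mem_erase.2 ⟨fun e => hwF (e ▸ hy), hFI hy⟩)
    have h4 := hmin _ hmem
    have h5 : sumIn G univ (insert v (I.erase w)) =
        dIn G univ v + sumIn G univ (I.erase w) := sum_insert hvI'
    have h6 : sumIn G univ (I.erase w) + dIn G univ w = sumIn G univ I := sum_erase_add _ _ hw
    omega
  have h7 : #(U \ I) * k ≤ sumIn G univ (U \ I) := by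
    rw [← smul_eq_mul]
    exact card_nsmul_le_sum _ _ _ hout
  have h8 : sumIn G univ (U \ I) + sumIn G univ I = sumIn G univ U := sum_sdiff hIU
  have h9 : #(U \ I) = x := by
    rw [card_sdiff_of_subset hIU]; omega
  rw [h9, mul_comm] at h7
  have := h I hFI hIU hIc
  omega

/-- For k = α, no subset of size α + 1 is light, so one has all degrees at most α - 1. It is large,
but its sum is at most (α + 1)(α - 1) < n. In the case of a low vertex u, every (k + 1)-subset
containing u is large; one of them has sum at most k + k(k - 1) = k² ≤ α² < n. -/
theorem not_good_univ [Nonempty V] (h : LargeHeavy G) :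
    ¬ Good G univ ∅ (LightIndep.alphaStar G) := by
  have hsq := alphaStar_sq_lt_card h
  have hpos := one_le_alphaStar (G := G)
  rintro (⟨U, -, hind, x, hc, hs⟩ | ⟨k, hk, U, u, ⟨-, hind, x, hc, hs⟩, hu, hd⟩)
  · obtain ⟨I, -, hIU, hIc, hI⟩ := exists_low_subset (F := ∅) hc (by simpa using hs)
      (empty_subset _) (by simp) fun I _ hIU hIc => by
        by_contra hlt
        have := card_le_alphaStar (fun u hu v hv => hind u (hIU hu) v (hIU hv))
          (by omega : sumIn G univ I + 1 ≤ Fintype.card V)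
        omega
    obtain ⟨w, hw⟩ := card_pos.1 (by omega : 0 < #I)
    have h1 := h I (fun u hu v hv => hind u (hIU hu) v (hIU hv)) w hw
      (by have := hI w hw (notMem_empty w); omega)
    have h2 : sumIn G univ I ≤ #I * (LightIndep.alphaStar G - 1) := by
      rw [← smul_eq_mul]
      exact sum_le_card_nsmul _ _ _ fun w hw => by
        have := hI w hw (notMem_empty w); omega
    rw [hIc] at h2
    obtain ⟨b, hb⟩ : ∃ b, LightIndep.alphaStar G = b + 1 := ⟨_, (Nat.sub_add_cancel hpos).symm⟩
    rw [hb] at h2 hsq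
    simp only [Nat.add_sub_cancel] at h2
    nlinarith
  · rw [sdiff_empty] at hd
    have hheavy : ∀ I, {u} ⊆ I → I ⊆ U → #I = k + 1 → Fintype.card V ≤ sumIn G univ I :=
      fun I huI hIU hIc => h I (fun u hu v hv => hind u (hIU hu) v (hIU hv)) u
        (singleton_subset_iff.1 huI) (by omega)
    obtain ⟨I, huI, hIU, hIc, hI⟩ := exists_low_subset (F := {u}) hc (by simpa using hs)
      (singleton_subset_iff.2 hu) (by simp) hheavy
    have h1 := hheavy I huI hIU hIc
    have huI := singleton_subset_iff.1 huI
    have h2 : sumIn G univ (I.erase u) + dIn G univ u = sumIn G univ I := sum_erase_add _ _ huI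
    have h3 : sumIn G univ (I.erase u) ≤ #(I.erase u) * (k - 1) := by
      rw [← smul_eq_mul]
      exact sum_le_card_nsmul _ _ _ fun w hw => by
        have := hI w (mem_of_mem_erase hw) (by simpa using ne_of_mem_erase hw); omega
    have h4 : #(I.erase u) = k := by rw [card_erase_of_mem huI]; omega
    rw [h4] at h3
    have h5 : k * k ≤ LightIndep.alphaStar G * LightIndep.alphaStar G := Nat.mul_le_mul hk hk
    rcases k with _ | k
    · simp at h3; omega
    · simp only [Nat.add_sub_cancel] at h3
      nlinarith

end Weights

/-! ### Two edge branches: the families 𝓕₁₁ and 𝓕₁₂ -/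

section Structure

variable {V : Type*} [Fintype V] [DecidableEq V] {G : SimpleGraph V} [DecidableRel G.Adj]
  {A B S T : Finset V} {z p q u u' v v' : V}

theorem dIn_univ_le (h : ∀ x, G.Adj u x → x ∈ A) : dIn G univ u ≤ #A :=
  (dIn_le_of_nbr fun x _ => h x).trans dIn_le_card

theorem adj_of_card_le (h : ∀ x, G.Adj u x → x ∈ A) (hc : #A ≤ dIn G univ u) :
    ∀ x ∈ A, G.Adj u x := by
  intro x hx
  by_contra hn
  have h1 := dIn_univ_le (A := A.erase x) fun y hy =>
    mem_erase.2 ⟨fun e => hn (e ▸ hy), h y hy⟩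
  have h2 := card_erase_add_one hx
  omega

theorem adj_or_adj_of_card_le (h : ∀ x, G.Adj u x → x ∈ A) (hc : #A ≤ dIn G univ u + 1) :
    ∀ x ∈ A, ∀ y ∈ A, x ≠ y → G.Adj u x ∨ G.Adj u y := by
  intro x hx y hy hxy
  by_contra! hn
  have h1 := dIn_univ_le (A := (A.erase x).erase y) fun w hw =>
    mem_erase.2 ⟨fun e => hn.2 (e ▸ hw), mem_erase.2 ⟨fun e => hn.1 (e ▸ hw), h w hw⟩⟩
  have h2 := card_erase_add_one hx
  have h3 := card_erase_add_one (mem_erase.2 ⟨hxy.symm, hy⟩)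
  omega

theorem LargeHeavy.pair (h : LargeHeavy G) {x y : V} (hxy : x ≠ y) (hn : ¬ G.Adj x y)
    (hx : dIn G univ x ≤ 1) : Fintype.card V ≤ dIn G univ x + dIn G univ y := by
  have hn' : ¬ G.Adj y x := fun h => hn h.symm
  have := h {x, y} (by simp [hn, hn']) x (by simp) (by rw [card_pair hxy]; omega)
  rwa [sumIn, sum_pair hxy] at this

theorem LargeHeavy.triple (h : LargeHeavy G) {x y w : V} (hxy : x ≠ y) (hxw : x ≠ w) (hyw : y ≠ w)
    (hn : ¬ G.Adj x y) (hn' : ¬ G.Adj x w) (hn'' : ¬ G.Adj y w) (hx : dIn G univ x ≤ 2) :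
    Fintype.card V ≤ dIn G univ x + dIn G univ y + dIn G univ w := by
  have h1 : x ∉ ({y, w} : Finset V) := by simp [hxy, hxw]
  have := h {x, y, w} (by simp [hn, hn', hn'', G.adj_comm y x, G.adj_comm w x, G.adj_comm w y]) x
    (by simp) (by rw [card_insert_of_notMem h1, card_pair hyw]; omega)
  rw [sumIn, sum_insert h1, sum_pair hyw] at this
  omega

/-- `S` together with the triangle or path on `p`, `u`, `u'` makes up `A`, where `p` separates
`{u, u'}` from `S` in `A` and `A` has no neighbour outside `A` other than `z`. -/
structure Branch (G : SimpleGraph V) (z p u u' : V) (A S : Finset V) : Prop where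
  eq : A = insert p (insert u (insert u' S))
  card : #A = #S + 3
  notMem : z ∉ A
  adj : G.Adj u u'
  nbr : ∀ x, G.Adj u x → x ∈ ({u', p, z} : Finset V)
  nbr' : ∀ x, G.Adj u' x → x ∈ ({u, p, z} : Finset V)
  nbr_rest : ∀ s ∈ S, ∀ x, G.Adj s x → x ∈ insert p (insert z (S.erase s))

namespace Branch

theorem symm (h : Branch G z p u u' A S) : Branch G z p u' u A S :=
  ⟨by rw [h.eq, insert_comm u u'], h.card, h.notMem, h.adj.symm, h.nbr', h.nbr, h.nbr_rest⟩

theorem mem_iff (h : Branch G z p u u' A S) {x : V} :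
    x ∈ A ↔ x = p ∨ x = u ∨ x = u' ∨ x ∈ S := by
  rw [h.eq]; simp

theorem exists_of_nbr (hA : EdgeBranch G A) (hz : z ∉ A)
    (hn : ∀ a ∈ A, ∀ x, G.Adj a x → x ∈ A ∨ x = z) :
    ∃ p u u' S, Branch G z p u u' A S ∧ S.Nonempty := by
  obtain ⟨p, hp, u, hu, u', hu', s, hs, hadj, hup, hup', hsp, hsu, hsu', h1, h2⟩ := hA
  have huu := hadj.ne
  refine ⟨p, u, u', ((A.erase p).erase u).erase u', ⟨?_, ?_, hz, hadj, ?_, ?_, ?_⟩, s, ?_⟩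
  · ext x
    simp only [mem_insert, mem_erase]
    constructor
    · intro hx; tauto
    · rintro (rfl | rfl | rfl | h)
      exacts [hp, hu, hu', h.2.2.2]
  · have e1 := card_erase_add_one hp
    have e2 := card_erase_add_one (mem_erase.2 ⟨hup, hu⟩)
    have e3 := card_erase_add_one (mem_erase.2 ⟨huu.symm, mem_erase.2 ⟨hup', hu'⟩⟩)
    omega
  · intro x hx
    simp only [mem_insert, mem_singleton]
    rcases hn u hu x hx with h | h
    · rcases h1 x h hx with h | h <;> simp [h]
    · simp [h]
  · intro x hx
    simp only [mem_insert, mem_singleton]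
    rcases hn u' hu' x hx with h | h
    · rcases h2 x h hx with h | h <;> simp [h]
    · simp [h]
  · intro t ht x hx
    simp only [mem_erase] at ht
    simp only [mem_insert, mem_erase]
    rcases hn t ht.2.2.2 x hx with h | h
    · have e1 : x ≠ u := by
        rintro rfl
        rcases h1 t ht.2.2.2 hx.symm with h | h <;> tauto
      have e2 : x ≠ u' := by
        rintro rfl
        rcases h2 t ht.2.2.2 hx.symm with h | h <;> tauto
      have := hx.ne'
      tauto
    · simp [h]
  · simp [hs, hsp, hsu, hsu']

variable (h : Branch G z p u u' A S)
include h

/-- The equality |A| = |S| + 3 leaves no room for coincidences. -/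
theorem distinct : p ≠ u ∧ p ≠ u' ∧ p ∉ S ∧ u ∉ S ∧ u' ∉ S := by
  have hc := h.card
  rw [h.eq] at hc
  have e1 := card_insert_le p (insert u (insert u' S))
  have e2 := card_insert_le u (insert u' S)
  have e3 := card_insert_le u' S
  have n1 : p ∉ insert u (insert u' S) := fun hm => by
    rw [insert_eq_of_mem hm] at hc; omega
  have n2 : u ∉ insert u' S := fun hm => by
    rw [insert_eq_of_mem hm] at hc e1; omega
  have n3 : u' ∉ S := fun hm => by
    rw [insert_eq_of_mem hm] at hc e1 e2; omega
  simp only [mem_insert, not_or] at n1 n2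
  tauto

theorem subset : S ⊆ A := fun _ hx => h.mem_iff.2 (by tauto)

theorem p_mem : p ∈ A := h.mem_iff.2 (by tauto)

theorem u_mem : u ∈ A := h.mem_iff.2 (by tauto)

theorem z_ne_p : z ≠ p := fun e => h.notMem (e ▸ h.p_mem)

theorem not_adj {s : V} (hs : s ∈ S) : ¬ G.Adj u s := fun hadj => by
  have hd := h.distinct
  have := h.nbr s hadj
  simp only [mem_insert, mem_singleton] at this
  rcases this with rfl | rfl | rfl
  · exact hd.2.2.2.2 hs
  · exact hd.2.2.1 hs
  · exact h.notMem (h.subset hs)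

theorem dIn_le_three : dIn G univ u ≤ 3 := (dIn_univ_le h.nbr).trans card_le_three

theorem card_nbr {s : V} (hs : s ∈ S) : #(insert p (insert z (S.erase s))) = #S + 1 := by
  have e := card_erase_add_one hs
  rw [card_insert_of_notMem, card_insert_of_notMem]
  · omega
  · exact fun hm => h.notMem (h.subset (mem_of_mem_erase hm))
  · rw [mem_insert, not_or]
    exact ⟨h.z_ne_p.symm, fun hm => h.distinct.2.2.1 (mem_of_mem_erase hm)⟩

theorem dIn_rest_le {s : V} (hs : s ∈ S) : dIn G univ s ≤ #S + 1 :=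
  (dIn_univ_le (h.nbr_rest s hs)).trans (h.card_nbr hs).le

theorem adj_of_three_le (h3 : 3 ≤ dIn G univ u) : G.Adj u p ∧ G.Adj u z := by
  have := adj_of_card_le h.nbr (card_le_three.trans h3)
  exact ⟨this p (by simp), this z (by simp)⟩

theorem twoConn_triangle (hp : G.Adj u p) (hp' : G.Adj u' p) : TwoConn G {p, u, u'} := by
  have hd := h.distinct
  have := h.adj
  refine twoConn_of_common ?_ ?_
  · rw [card_insert_of_notMem (by simp [hd]), card_pair this.ne]
  · intro x hx y hy hne hn
    simp only [mem_insert, mem_singleton] at hx hy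
    have := this.symm
    have := hp.symm
    have := hp'.symm
    rcases hx with rfl | rfl | rfl <;> rcases hy with rfl | rfl | rfl <;> contradiction

/-- Otherwise the triangle p, u, u' and S would cover A with two parts. -/
theorem not_twoConn_rest (hp : G.Adj u p) (hp' : G.Adj u' p) (hc : ¬ Cov G A ∅ 2) :
    ¬ TwoConn G S := by
  intro hS
  have hd := h.distinct
  refine hc ((h.twoConn_triangle hp hp').cov.add (X := ∅) (Y := ∅) (hS.cov) ?_ ?_ h.subset le_rfl ?_)
  · simp [hd]
  · intro x hx
    simp only [mem_insert, mem_singleton] at hx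
    exact h.mem_iff.2 (by tauto)
  · intro x hx _
    have := h.mem_iff.1 hx
    simp only [mem_insert, mem_singleton, notMem_empty]
    tauto

end Branch

theorem twoConn_of_dominating_pair {z p : V} {Y : Finset V} (hzp : z ≠ p) (h2 : 2 ≤ #Y)
    (hz : ∀ y ∈ Y, G.Adj z y) (hp : ∀ y ∈ Y, G.Adj p y) : TwoConn G (insert z (insert p Y)) := by
  have hzY : z ∉ Y := fun h => G.irrefl (hz z h)
  have hpY : p ∉ Y := fun h => G.irrefl (hp p h)
  obtain ⟨a, ha, b, hb, hab⟩ := one_lt_card.1 (by omega : 1 < #Y)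
  refine twoConn_of_common ?_ ?_
  · rw [card_insert_of_notMem (by simp [hzp, hzY]), card_insert_of_notMem hpY]; omega
  · intro x hx y hy hne hn
    simp only [mem_insert] at hx hy
    have hz' := fun y hy => (hz y hy).symm
    have hp' := fun y hy => (hp y hy).symm
    rcases hx with rfl | rfl | hx <;> rcases hy with rfl | rfl | hy
    · exact absurd rfl hne
    · exact ⟨a, by simp [ha], b, by simp [hb], hab, hz a ha, hp' a ha, hz b hb, hp' b hb⟩
    · exact absurd (hz y hy) hn
    · exact ⟨a, by simp [ha], b, by simp [hb], hab, hp a ha, hz' a ha, hp b hb, hz' b hb⟩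
    · exact absurd rfl hne
    · exact absurd (hp y hy) hn
    · exact absurd (hz' x hx) hn
    · exact absurd (hp' x hx) hn
    · exact ⟨z, by simp, p, by simp, hzp, hz' x hx, hz y hy, hp' x hx, hp y hy⟩

/-- Both sides of the cut vertex `z` are branches and large independent sets are heavy. -/
structure TwoBranches (G : SimpleGraph V) [DecidableRel G.Adj] (z p q u u' v v' : V)
    (A B S T : Finset V) : Prop where
  heavy : LargeHeavy G
  split : Split G univ z A B
  left : Branch G z p u u' A S
  right : Branch G z q v v' B T
  left_nonempty : S.Nonempty
  right_nonempty : T.Nonempty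

namespace TwoBranches

theorem symm (h : TwoBranches G z p q u u' v v' A B S T) :
    TwoBranches G z q p v v' u u' B A T S :=
  ⟨h.heavy, h.split.symm, h.right, h.left, h.right_nonempty, h.left_nonempty⟩

theorem flip_left (h : TwoBranches G z p q u u' v v' A B S T) :
    TwoBranches G z p q u' u v v' A B S T :=
  ⟨h.heavy, h.split, h.left.symm, h.right, h.left_nonempty, h.right_nonempty⟩

variable (h : TwoBranches G z p q u u' v v' A B S T)
include h

theorem card : Fintype.card V = #S + #T + 7 := by
  have h1 := h.split.card
  rw [card_univ, h.left.card, h.right.card] at h1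
  omega

theorem ne {a b : V} (ha : a ∈ A) (hb : b ∈ B) : a ≠ b := fun e =>
  disjoint_left.1 h.split.disj ha (e ▸ hb)

/-- The independent triple u, s, v is large as soon as u or s has degree at most 2. -/
theorem le_of_left {s : V} (hs : s ∈ S) (hd : dIn G univ u ≤ 2 ∨ dIn G univ s ≤ 2) :
    Fintype.card V ≤ dIn G univ u + dIn G univ s + dIn G univ v := by
  have n1 : u ≠ s := fun e => h.left.distinct.2.2.2.1 (e ▸ hs)
  have n2 := h.left.not_adj hs
  have n3 := h.ne h.left.u_mem h.right.u_mem
  have n4 := h.ne (h.left.subset hs) h.right.u_mem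
  have n5 := h.split.anti u h.left.u_mem v h.right.u_mem
  have n6 := h.split.anti s (h.left.subset hs) v h.right.u_mem
  rcases hd with hd | hd
  · exact h.heavy.triple n1 n3 n4 n2 n5 n6 hd
  · have := h.heavy.triple n1.symm n4 n3 (fun h => n2 h.symm) n6 n5 hd
    omega

/-- Otherwise the triple u, s, v has sum at most 2 + (|S| + 1) + 3, which is less than n = |S| + |T|
+ 7. -/
theorem three_le_dIn : 3 ≤ dIn G univ u := by
  by_contra hlt
  obtain ⟨s, hs⟩ := h.left_nonempty
  have h1 := h.le_of_left hs (Or.inl (by omega))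
  have h2 := h.left.dIn_rest_le hs
  have h3 := h.right.dIn_le_three
  have := h.card
  omega

theorem adj_left : G.Adj u p ∧ G.Adj u z := h.left.adj_of_three_le h.three_le_dIn

theorem two_le_card : 2 ≤ #S := by
  obtain ⟨s, hs⟩ := h.left_nonempty
  by_contra hlt
  have h2 := h.left.dIn_rest_le hs
  have h1 := h.le_of_left hs (Or.inr (by omega))
  have h3 := h.right.dIn_le_three
  have h4 := h.left.dIn_le_three
  have h5 := h.card
  have h6 := card_pos.2 h.right_nonempty
  have h7 := card_pos.2 h.left_nonempty
  omega

/-- The independent set u, s, v, t is large because u has degree at most 3, and u and v contribute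
at most 6 to a sum of at least |S| + |T| + 7. -/
theorem le_of_mem {s t : V} (hs : s ∈ S) (ht : t ∈ T) :
    #S + #T + 1 ≤ dIn G univ s + dIn G univ t := by
  have hu := h.left.u_mem
  have hv := h.right.u_mem
  have hsA := h.left.subset hs
  have htB := h.right.subset ht
  have n1 : u ≠ s := fun e => h.left.distinct.2.2.2.1 (e ▸ hs)
  have n2 : v ≠ t := fun e => h.right.distinct.2.2.2.1 (e ▸ ht)
  have a1 := h.left.not_adj hs
  have a2 := h.right.not_adj ht
  have an := h.split.anti
  have m2 : s ∉ ({v, t} : Finset V) := by simp [h.ne hsA hv, h.ne hsA htB]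
  have m1 : u ∉ ({s, v, t} : Finset V) := by simp [n1, h.ne hu hv, h.ne hu htB]
  have hind : ∀ x ∈ ({u, s, v, t} : Finset V), ∀ y ∈ ({u, s, v, t} : Finset V), ¬ G.Adj x y := by
    simp [a1, a2, an u hu v hv, an u hu t htB, an s hsA v hv, an s hsA t htB,
      G.adj_comm s u, G.adj_comm v u, G.adj_comm t u, G.adj_comm v s, G.adj_comm t s,
      G.adj_comm t v]
  have h1 := h.heavy _ hind u (by simp) (by
    rw [card_insert_of_notMem m1, card_insert_of_notMem m2, card_pair n2]
    have := h.left.dIn_le_three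
    omega)
  rw [sumIn, sum_insert m1, sum_insert m2, sum_pair n2] at h1
  have h3 := h.right.dIn_le_three
  have h4 := h.left.dIn_le_three
  have h5 := h.card
  omega

theorem twoConn_right (hT : ∀ t ∈ T, ∀ x ∈ insert q (insert z (T.erase t)), G.Adj t x) :
    TwoConn G (insert z B) := by
  have h1 := h.symm.adj_left
  have h2 := h.symm.flip_left.adj_left
  rw [h.right.eq]
  refine twoConn_of_dominating_pair h.right.z_ne_p ?_ ?_ ?_
  · rw [← card_pair h.right.adj.ne]
    exact card_le_card fun x => by simp only [mem_insert, mem_singleton]; tauto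
  · intro y hy
    simp only [mem_insert] at hy
    rcases hy with rfl | rfl | hy
    exacts [h1.2.symm, h2.2.symm, (hT y hy z (by simp)).symm]
  · intro y hy
    simp only [mem_insert] at hy
    rcases hy with rfl | rfl | hy
    exacts [h1.1.symm, h2.1.symm, (hT y hy q (by simp)).symm]

theorem not_twoConn_left (hc : ¬ Cov G univ ∅ 3) (hB : TwoConn G (insert z B)) :
    ¬ TwoConn G S :=
  h.left.not_twoConn_rest h.adj_left.1 h.flip_left.adj_left.1 (h.split.not_cov_left hB hc)

theorem eq_pair (hc : ¬ Cov G univ ∅ 3) (hB : TwoConn G (insert z B))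
    (hS : ∀ x ∈ S, ∀ y ∈ S, x ≠ y → G.Adj x y) : #S = 2 := by
  have h1 := h.not_twoConn_left hc hB
  have h2 := h.two_le_card
  by_contra hne
  exact h1 (twoConn_of_common (by omega) fun x hx y hy hxy hn => absurd (hS x hx y hy hxy) hn)

-- Here T is complete and joined to q and z, so z + B is a single part and S cannot be 2-connected.
-- Every vertex of S misses at most one possible neighbour. If |S| = 2, nothing is missing. If |S| ≥
-- 3, some nonadjacent pair s, s' exists, and |S| ≥ 4 would give every such pair two common
-- neighbours in S; hence |S| = 3. In both cases z + A is 2-connected, so the complete set T has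
-- only two vertices.
set_option maxHeartbeats 800000 in
theorem exceptional_of_full (hc : ¬ Cov G univ ∅ 3)
    (hT : ∀ t ∈ T, ∀ x ∈ insert q (insert z (T.erase t)), G.Adj t x)
    (hS : ∀ s ∈ S, #S ≤ dIn G univ s) : LightIndep.IsInF11 G ∨ LightIndep.IsInF12 G := by
  have hB := h.twoConn_right hT
  have hnS := h.not_twoConn_left hc hB
  have h2 := h.two_le_card
  have hTT : ∀ x ∈ T, ∀ y ∈ T, x ≠ y → G.Adj x y := fun x hx y hy hxy =>
    hT x hx y (by simp [hy, hxy.symm])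
  have hmiss : ∀ s ∈ S, ∀ x ∈ insert p (insert z (S.erase s)),
      ∀ y ∈ insert p (insert z (S.erase s)), x ≠ y → G.Adj s x ∨ G.Adj s y := fun s hs =>
    adj_or_adj_of_card_le (h.left.nbr_rest s hs) (by rw [h.left.card_nbr hs]; have := hS s hs; omega)
  have hu := h.adj_left
  have hu' := h.flip_left.adj_left
  have hv := h.symm.adj_left
  have hv' := h.symm.flip_left.adj_left
  have hcover : ∀ x, x = z ∨ (x = p ∨ x = u ∨ x = u' ∨ x ∈ S) ∨ (x = q ∨ x = v ∨ x = v' ∨ x ∈ T) :=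
    fun x => by
      rw [← h.left.mem_iff, ← h.right.mem_iff]
      exact h.split.mem_iff.1 (mem_univ x)
  have hn := h.split.anti
  rw [h.left.eq, h.right.eq] at hn
  have hnu : ∀ x ∈ ({u, u'} : Finset V), ∀ y ∈ S, ¬ G.Adj x y := by
    intro x hx y hy
    simp only [mem_insert, mem_singleton] at hx
    rcases hx with rfl | rfl
    exacts [h.left.not_adj hy, h.left.symm.not_adj hy]
  have hnv : ∀ x ∈ ({v, v'} : Finset V), ∀ y ∈ T, ¬ G.Adj x y := by
    intro x hx y hy
    simp only [mem_insert, mem_singleton] at hx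
    rcases hx with rfl | rfl
    exacts [h.right.not_adj hy, h.right.symm.not_adj hy]
  obtain hS2 | hS3 : #S = 2 ∨ 3 ≤ #S := by omega
  · left
    have hfull : ∀ s ∈ S, ∀ x ∈ insert p (insert z (S.erase s)), G.Adj s x := by
      intro s hs
      refine adj_of_card_le (h.left.nbr_rest s hs) ?_
      rw [h.left.card_nbr hs]
      by_contra hlt
      have e1 := h.le_of_left hs (Or.inr (by omega))
      have e2 := h.left.dIn_le_three
      have e3 := h.right.dIn_le_three
      have e4 := h.card
      have e5 := h.symm.two_le_card
      omega
    have hT2 := h.symm.eq_pair hc (h.symm.twoConn_right hfull) hTT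
    obtain ⟨s, s', hss, rfl⟩ := card_eq_two.1 hS2
    obtain ⟨t, t', htt, rfl⟩ := card_eq_two.1 hT2
    refine isInF11_of (z := z) (p := p) (q := q) (u := u) (u' := u') (s := s) (s' := s') (v := v)
      (v' := v') (t := t) (t' := t') ?_ ?_ ?_ h.left.adj
      (hfull s (by simp) s' (by simp [hss.symm])) h.right.adj (hTT t (by simp) t' (by simp) htt)
      hn hnu hnv ?_ ?_
    · have a1 := fun s hs => (hfull s hs z (by simp)).symm
      have a2 := fun s hs => (hT s hs z (by simp)).symm
      simp only [mem_insert, mem_singleton, forall_eq_or_imp, forall_eq] at a1 a2 ⊢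
      exact ⟨hu.2.symm, hu'.2.symm, a1.1, a1.2, hv.2.symm, hv'.2.symm, a2.1, a2.2⟩
    · have a1 := fun s hs => (hfull s hs p (by simp)).symm
      simp only [mem_insert, mem_singleton, forall_eq_or_imp, forall_eq] at a1 ⊢
      exact ⟨hu.1.symm, hu'.1.symm, a1.1, a1.2⟩
    · have a2 := fun s hs => (hT s hs q (by simp)).symm
      simp only [mem_insert, mem_singleton, forall_eq_or_imp, forall_eq] at a2 ⊢
      exact ⟨hv.1.symm, hv'.1.symm, a2.1, a2.2⟩
    · simpa only [mem_insert, mem_singleton] using hcover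
    · rw [h.card, hS2, hT2]
  · right
    obtain ⟨s, hs, s', hs', hss, hnss⟩ : ∃ s ∈ S, ∃ s' ∈ S, s ≠ s' ∧ ¬ G.Adj s s' := by
      by_contra! hall
      exact hnS (twoConn_of_common hS3 fun x hx y hy hxy hn => absurd (hall x hx y hy hxy) hn)
    have hrest : ∀ a b, a ∈ S → b ∈ S → a ≠ b → ¬ G.Adj a b →
        ∀ x ∈ insert p (insert z (S.erase a)), x ≠ b → G.Adj a x := by
      intro a b ha hb hab hnab x hx hxb
      rcases hmiss a ha x hx b (by simp [hb, hab.symm]) hxb with h | h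
      · exact h
      · exact absurd h hnab
    have hSc : #S = 3 := by
      by_contra hne
      refine hnS (twoConn_of_common hS3 fun x hx y hy hxy hnxy => ?_)
      have e1 := card_erase_add_one hx
      have e2 := card_erase_add_one (mem_erase.2 ⟨hxy.symm, hy⟩)
      obtain ⟨a, ha, b, hb, hab⟩ := one_lt_card.1 (by omega : 1 < #((S.erase x).erase y))
      have key : ∀ c ∈ (S.erase x).erase y, c ∈ S ∧ G.Adj x c ∧ G.Adj c y := by
        intro c hc
        simp only [mem_erase] at hc
        exact ⟨hc.2.2, hrest x y hx hy hxy hnxy c (by simp [hc]) hc.1,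
          (hrest y x hy hx hxy.symm (fun h => hnxy h.symm) c (by simp [hc]) hc.2.1).symm⟩
      exact ⟨a, (key a ha).1, b, (key b hb).1, hab, (key a ha).2.1, (key a ha).2.2,
        (key b hb).2.1, (key b hb).2.2⟩
    have e1 := card_erase_add_one hs
    have e2 := card_erase_add_one (mem_erase.2 ⟨hss.symm, hs'⟩)
    obtain ⟨g, hg⟩ := card_eq_one.1 (by omega : #((S.erase s).erase s') = 1)
    have hgm : g ∈ (S.erase s).erase s' := by simp [hg]
    simp only [mem_erase] at hgm
    obtain ⟨hgs', hgs, hgS⟩ := hgm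
    have hSeq : S = {s, s', g} := by
      ext x
      have : x ∈ (S.erase s).erase s' ↔ x = g := by rw [hg, mem_singleton]
      simp only [mem_erase] at this
      simp only [mem_insert, mem_singleton]
      constructor
      · intro hx; tauto
      · rintro (rfl | rfl | rfl) <;> assumption
    have hd := h.left.distinct
    have hps : p ≠ s := fun e => hd.2.2.1 (e ▸ hs)
    have hps' : p ≠ s' := fun e => hd.2.2.1 (e ▸ hs')
    have hzs : z ≠ s := fun e => h.left.notMem (h.left.subset (e ▸ hs))
    have hzs' : z ≠ s' := fun e => h.left.notMem (h.left.subset (e ▸ hs'))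
    have r1 := hrest s s' hs hs' hss hnss
    have r2 := hrest s' s hs' hs hss.symm (fun h => hnss h.symm)
    have sp := r1 p (by simp) hps'
    have sz := r1 z (by simp) hzs'
    have sg := r1 g (by simp [hgs, hgS]) hgs'
    have sp' := r2 p (by simp) hps
    have sz' := r2 z (by simp) hzs
    have sg' := r2 g (by simp [hgs', hgS]) hgs
    -- The vertices z and p dominate u, u', s, s'. The third vertex g of S is then attached through
    -- s and s'.
    have hA : TwoConn G (insert z A) := by
      have hbase : TwoConn G (insert z (insert p {u, u', s, s'})) := by
        refine twoConn_of_dominating_pair h.left.z_ne_p ?_ ?_ ?_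
        · rw [← card_pair hss]
          exact card_le_card fun x => by simp only [mem_insert, mem_singleton]; tauto
        · simp only [mem_insert, mem_singleton, forall_eq_or_imp, forall_eq]
          exact ⟨hu.2.symm, hu'.2.symm, sz.symm, sz'.symm⟩
        · simp only [mem_insert, mem_singleton, forall_eq_or_imp, forall_eq]
          exact ⟨hu.1.symm, hu'.1.symm, sp.symm, sp'.symm⟩
      have hgn : g ∉ insert z (insert p ({u, u', s, s'} : Finset V)) := by
        simp only [mem_insert, mem_singleton, not_or]
        exact ⟨fun e => h.left.notMem (h.left.subset (e ▸ hgS)), fun e => hd.2.2.1 (e ▸ hgS),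
          fun e => hd.2.2.2.1 (e ▸ hgS), fun e => hd.2.2.2.2 (e ▸ hgS), hgs, hgs'⟩
      have := hbase.insert_vertex hgn (by simp : s ∈ _) (by simp : s' ∈ _) hss sg.symm sg'.symm
      convert this using 1
      rw [h.left.eq, hSeq]
      ext x
      simp only [mem_insert, mem_singleton]
      tauto
    have hT2 := h.symm.eq_pair hc hA hTT
    -- As g misses at most one possible neighbour, it sees z or p; this is the nonemptiness
    -- condition in 𝓕₁₂.
    have hgpz := hmiss g hgS z (by simp) p (by simp) h.left.z_ne_p
    obtain ⟨t, t', htt, rfl⟩ := card_eq_two.1 hT2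
    subst hSeq
    refine isInF12_of (z := z) (p := p) (q := q) (u := u) (u' := u') (s := s) (s' := s') (g := g)
      (v := v) (v' := v') (t := t) (t' := t') ?_ ?_ ?_ h.left.adj ?_ h.right.adj
      (hTT t (by simp) t' (by simp) htt) hnss ?_ hn hnu hnv ?_ ?_
    · have a2 := fun s hs => (hT s hs z (by simp)).symm
      simp only [mem_insert, mem_singleton, forall_eq_or_imp, forall_eq] at a2 ⊢
      exact ⟨hu.2.symm, hu'.2.symm, sz.symm, sz'.symm, hv.2.symm, hv'.2.symm, a2.1, a2.2⟩
    · simp only [mem_insert, mem_singleton, forall_eq_or_imp, forall_eq]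
      exact ⟨hu.1.symm, hu'.1.symm, sp.symm, sp'.symm⟩
    · have a2 := fun s hs => (hT s hs q (by simp)).symm
      simp only [mem_insert, mem_singleton, forall_eq_or_imp, forall_eq] at a2 ⊢
      exact ⟨hv.1.symm, hv'.1.symm, a2.1, a2.2⟩
    · simp only [mem_insert, mem_singleton, forall_eq_or_imp, forall_eq]
      exact ⟨sg.symm, sg'.symm⟩
    · exact hgpz.imp (fun h => h.symm) (fun h => h.symm)
    · simpa only [mem_insert, mem_singleton] using hcover
    · rw [h.card, hSc, hT2]

/-- Degrees in S and T are at most |S| + 1 and |T| + 1, while d(s) + d(t) ≥ |S| + |T| + 1. Hence one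
side attains its maximum everywhere and the other is short by at most one at each vertex. -/
theorem exceptional (hc : ¬ Cov G univ ∅ 3) : LightIndep.IsInF11 G ∨ LightIndep.IsInF12 G := by
  by_cases hT : ∀ t ∈ T, #T + 1 ≤ dIn G univ t
  · refine h.exceptional_of_full hc (fun t ht => adj_of_card_le (h.right.nbr_rest t ht) ?_) ?_
    · rw [h.right.card_nbr ht]; exact hT t ht
    · obtain ⟨t, ht⟩ := h.right_nonempty
      intro s hs
      have h1 := h.le_of_mem hs ht
      have h2 := h.right.dIn_rest_le ht
      omega
  · push Not at hT
    obtain ⟨t, ht, hlt⟩ := hT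
    refine h.symm.exceptional_of_full hc
      (fun s hs => adj_of_card_le (h.left.nbr_rest s hs) ?_) fun t ht => ?_
    · rw [h.left.card_nbr hs]
      have h1 := h.le_of_mem hs ht
      omega
    · obtain ⟨s, hs⟩ := h.left_nonempty
      have h1 := h.le_of_mem hs ht
      have h2 := h.left.dIn_rest_le hs
      omega

end TwoBranches

theorem TwoEdgeBranches.exceptional (h : TwoEdgeBranches G univ) (hσ : LargeHeavy G)
    (hc : ¬ Cov G univ ∅ 3) : LightIndep.IsInF11 G ∨ LightIndep.IsInF12 G := by
  obtain ⟨z, A, B, hs, hA, hB⟩ := h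
  obtain ⟨p, u, u', S, hl, hS⟩ := Branch.exists_of_nbr hA hs.notMem_left
    fun a ha x => hs.nbr ha (mem_univ x)
  obtain ⟨q, v, v', T, hr, hT⟩ := Branch.exists_of_nbr hB hs.notMem_right
    fun a ha x => hs.symm.nbr ha (mem_univ x)
  exact TwoBranches.exceptional ⟨hσ, hs, hl, hr, hS, hT⟩ hc

end Structure

/-! ### One edge branch: F₅ and the family 𝓗ₙ -/

section EdgeBranch

variable {V : Type*} [Fintype V] [DecidableEq V] {G : SimpleGraph V} [DecidableRel G.Adj]
  {A B S : Finset V} {z u u' b : V}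

/-- `{u, u'}` is a component of `G - z` and `S` is the set of the other vertices. -/
structure PendantEdge (G : SimpleGraph V) [DecidableRel G.Adj] (z u u' : V) (S : Finset V) :
    Prop where
  heavy : LargeHeavy G
  cover : ∀ x, x = z ∨ x = u ∨ x = u' ∨ x ∈ S
  card : Fintype.card V = #S + 3
  notMem : z ∉ S ∧ u ∉ S ∧ u' ∉ S
  ne : z ≠ u ∧ z ≠ u'
  adj : G.Adj u u'
  nbr : ∀ x, G.Adj u x → x = u' ∨ x = z
  nbr' : ∀ x, G.Adj u' x → x = u ∨ x = z
  nonempty : S.Nonempty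

namespace PendantEdge

theorem symm (h : PendantEdge G z u u' S) : PendantEdge G z u' u S :=
  ⟨h.heavy, fun x => by have := h.cover x; tauto, h.card, ⟨h.notMem.1, h.notMem.2.2, h.notMem.2.1⟩,
    h.ne.symm, h.adj.symm, h.nbr', h.nbr, h.nonempty⟩

theorem exists_of_edgeBranch (hσ : LargeHeavy G) (h : EdgeBranch G univ) :
    ∃ z u u' S, PendantEdge G z u u' S := by
  obtain ⟨z, -, u, -, u', -, s, -, hadj, huz, huz', hsz, hsu, hsu', hnu, hnu'⟩ := h
  have hne := hadj.ne
  refine ⟨z, u, u', univ \ {z, u, u'}, hσ, fun x => ?_, ?_, by simp, ⟨huz.symm, huz'.symm⟩, hadj,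
    fun x => hnu x (mem_univ x), fun x => hnu' x (mem_univ x), s, by simp [hsz, hsu, hsu']⟩
  · simp only [mem_sdiff, mem_univ, mem_insert, mem_singleton, true_and]; tauto
  · have h1 : #({z, u, u'} : Finset V) = 3 := by
      rw [card_insert_of_notMem (by simp [huz.symm, huz'.symm]), card_pair hne]
    rw [← h1, card_sdiff_add_card_eq_card (subset_univ _), card_univ]

variable (h : PendantEdge G z u u' S)
include h

theorem not_adj {s : V} (hs : s ∈ S) : ¬ G.Adj u s := fun hadj => by
  rcases h.nbr s hadj with rfl | rfl
  exacts [h.notMem.2.2 hs, h.notMem.1 hs]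

theorem u_ne {s : V} (hs : s ∈ S) : u ≠ s := by
  rintro rfl
  exact h.notMem.2.1 hs

theorem nbr_rest {s x : V} (hs : s ∈ S) (hadj : G.Adj s x) : x ∈ insert z S := by
  rcases h.cover x with rfl | rfl | rfl | hx
  · simp
  · exact absurd hadj.symm (h.not_adj hs)
  · exact absurd hadj.symm (h.symm.not_adj hs)
  · simp [hx]

theorem dIn_rest_le {s : V} (hs : s ∈ S) : dIn G univ s ≤ #S := by
  have h1 := dIn_univ_le (u := s) (A := insert z (S.erase s)) fun x hx => by
    have := h.nbr_rest hs hx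
    have := hx.ne'
    simp only [mem_insert, mem_erase] at *
    tauto
  have h2 := card_insert_le z (S.erase s)
  have h3 := card_erase_add_one hs
  omega

theorem dIn_le : dIn G univ u ≤ 2 := by
  refine (dIn_univ_le (A := {u', z}) fun x hx => ?_).trans card_le_two
  simpa using h.nbr x hx

/-- Otherwise u has degree at most 1, and u with any s in S would be large of sum at most 1 + |S| <
n. -/
theorem adj_center : G.Adj z u := by
  by_contra hn
  obtain ⟨s, hs⟩ := h.nonempty
  have h1 := dIn_univ_le (u := u) (A := {u'}) fun x hx => by
    rcases h.nbr x hx with h | rfl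
    · simp [h]
    · exact absurd hx.symm hn
  rw [card_singleton] at h1
  have h2 := h.heavy.pair (h.u_ne hs) (h.not_adj hs) h1
  have h3 := h.dIn_rest_le hs
  have h4 := h.card
  omega

/-- The triple u, s, t is large since u has degree at most 2, and n = |S| + 3. -/
theorem le_of_not_adj {s t : V} (hs : s ∈ S) (ht : t ∈ S) (hst : s ≠ t) (hn : ¬ G.Adj s t) :
    #S + 1 ≤ dIn G univ s + dIn G univ t := by
  have h1 := h.heavy.triple (h.u_ne hs) (h.u_ne ht) hst
    (h.not_adj hs) (h.not_adj ht) hn h.dIn_le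
  have h2 := h.dIn_le
  have h3 := h.card
  omega

theorem two_le_dIn_rest {s : V} (hs : s ∈ S) : 2 ≤ dIn G univ s := by
  by_contra hlt
  have h1 := h.heavy.pair (h.u_ne hs).symm (fun hadj => h.not_adj hs hadj.symm)
    (by omega : dIn G univ s ≤ 1)
  have h2 := h.dIn_le
  have h3 := h.card
  have h4 := card_pos.2 h.nonempty
  omega

/-- Otherwise the triangle z, u, u' and S would be a cover with two parts. -/
theorem not_twoConn (hc : ¬ Cov G univ ∅ 2) : ¬ TwoConn G S := by
  intro hS
  have hzu := h.adj_center
  have hzu' := h.symm.adj_center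
  have hT : TwoConn G {z, u, u'} := by
    refine twoConn_of_common ?_ ?_
    · rw [card_insert_of_notMem (by simp [h.ne]), card_pair h.adj.ne]
    · intro x hx y hy hne hn
      simp only [mem_insert, mem_singleton] at hx hy
      have := h.adj
      have := this.symm
      have := hzu.symm
      have := hzu'.symm
      rcases hx with rfl | rfl | rfl <;> rcases hy with rfl | rfl | rfl <;> contradiction
  refine hc (hT.cov.add (X := ∅) (Y := ∅) hS.cov ?_ (subset_univ _) (subset_univ _) le_rfl ?_)
  · simp [h.notMem]
  · intro x _ _
    have := h.cover x
    simp only [mem_insert, mem_singleton, notMem_empty]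
    tauto

theorem two_le_card : 2 ≤ #S := by
  obtain ⟨s, hs⟩ := h.nonempty
  exact (h.two_le_dIn_rest hs).trans (h.dIn_rest_le hs)

theorem iso_F5 (h2 : #S = 2) : Nonempty (G ≃g LightIndep.F5) := by
  have hd := fun s hs => h.two_le_dIn_rest (s := s) hs
  have hcover := h.cover
  have hrest := fun s hs x => h.nbr_rest (s := s) (x := x) hs
  have hn := fun s hs => h.not_adj (s := s) hs
  have hn' := fun s hs => h.symm.not_adj (s := s) hs
  have hz := h.notMem.1
  have hc := h.card
  have key : ∀ s t, s ≠ t → S = {s, t} → G.Adj s z ∧ G.Adj s t := by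
    rintro s t hst rfl
    have := adj_of_card_le (u := s) (A := {z, t}) (fun x hx => by
      have h1 := hrest s (by simp) x hx
      have h2 := hx.ne'
      simp only [mem_insert, mem_singleton] at h1 ⊢
      tauto) (card_le_two.trans (hd s (by simp)))
    exact ⟨this z (by simp), this t (by simp)⟩
  obtain ⟨s, t, hst, hS⟩ := card_eq_two.1 h2
  obtain ⟨a1, a2⟩ := key s t hst hS
  obtain ⟨a3, -⟩ := key t s hst.symm (by rw [hS, pair_comm])
  subst hS
  refine nonempty_iso_F5 (z := z) (u := u) (u' := u') (s := s) (s' := t) ?_ h.adj a2 ?_ ?_ ?_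
  · simp only [mem_insert, mem_singleton, forall_eq_or_imp, forall_eq]
    exact ⟨h.adj_center, h.symm.adj_center, a1.symm, a3.symm⟩
  · intro x hx y hy
    simp only [mem_insert, mem_singleton] at hx
    rcases hx with rfl | rfl
    exacts [hn y hy, hn' y hy]
  · simpa only [mem_insert, mem_singleton] using hcover
  · rw [hc, h2]

/-- For s in A and t in B the degrees are at most |A| + 1 and |B| + 1, while their sum is at least
|S| + 1 = |A| + |B| + 2. Equality holds throughout, so A and B are complete and joined to both z and
b. -/
theorem isInH (hs : Split G S b A B) (hA : A.Nonempty) (hB : B.Nonempty) (hAB : #A ≤ #B) :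
    LightIndep.IsInH G (Fintype.card V) := by
  have hcard := hs.card
  have hc := h.card
  have hzA : z ∉ A := fun hm => h.notMem.1 (hs.left_subset hm)
  have hzB : z ∉ B := fun hm => h.notMem.1 (hs.right_subset hm)
  have hzb : z ≠ b := fun e => h.notMem.1 (e ▸ hs.mem_center)
  have hcl : ∀ A B, Split G S b A B → z ∉ A → ∀ s ∈ A, #(insert z (insert b (A.erase s))) = #A + 1 ∧
      ∀ x, G.Adj s x → x ∈ insert z (insert b (A.erase s)) := by
    intro A B hs hzA s hsA
    constructor
    · have := card_erase_add_one hsA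
      rw [card_insert_of_notMem (by
        simp only [mem_insert, not_or]; exact ⟨hzb, fun hm => hzA (mem_of_mem_erase hm)⟩),
        card_insert_of_notMem fun hm => hs.notMem_left (mem_of_mem_erase hm)]
      omega
    · intro x hx
      have h1 := hx.ne'
      rcases mem_insert.1 (h.nbr_rest (hs.left_subset hsA) hx) with h2 | h2
      · simp [h2]
      · rcases hs.nbr hsA h2 hx with h3 | h3 <;> simp [h3, h1]
  have hsum : ∀ s ∈ A, ∀ t ∈ B, #A + 1 + (#B + 1) ≤ dIn G univ s + dIn G univ t := by
    intro s hsA t htB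
    have := h.le_of_not_adj (hs.left_subset hsA) (hs.right_subset htB)
      (fun e => disjoint_left.1 hs.disj hsA (e ▸ htB)) (hs.anti s hsA t htB)
    omega
  have hle : ∀ s ∈ A, dIn G univ s ≤ #A + 1 := fun s hsA => by
    rw [← (hcl A B hs hzA s hsA).1]
    exact dIn_univ_le (hcl A B hs hzA s hsA).2
  have hle' : ∀ t ∈ B, dIn G univ t ≤ #B + 1 := fun t htB => by
    rw [← (hcl B A hs.symm hzB t htB).1]
    exact dIn_univ_le (hcl B A hs.symm hzB t htB).2
  have hfA : ∀ s ∈ A, ∀ x ∈ insert z (insert b (A.erase s)), G.Adj s x := fun s hsA => by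
    obtain ⟨t, htB⟩ := hB
    refine adj_of_card_le (hcl A B hs hzA s hsA).2 ?_
    have := hsum s hsA t htB
    have := hle' t htB
    have := (hcl A B hs hzA s hsA).1
    omega
  have hfB : ∀ t ∈ B, ∀ x ∈ insert z (insert b (B.erase t)), G.Adj t x := fun t htB => by
    obtain ⟨s, hsA⟩ := hA
    refine adj_of_card_le (hcl B A hs.symm hzB t htB).2 ?_
    have := hsum s hsA t htB
    have := hle s hsA
    have := (hcl B A hs.symm hzB t htB).1
    omega
  have hA1 := card_pos.2 hA
  refine ⟨#A + 1, #B + 1, by omega, by omega, by omega, ?_⟩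
  refine nonempty_iso_H rfl rfl (z := z) (b := b) (u := u) (u' := u') ?_ ?_ h.adj h.adj_center
    h.symm.adj_center ?_ ?_ hs.anti ?_ ?_ (by omega)
  · intro x hx
    rcases mem_union.1 hx with hx | hx
    exacts [(hfA x hx z (by simp)).symm, (hfB x hx z (by simp)).symm]
  · intro x hx
    rcases mem_union.1 hx with hx | hx
    exacts [(hfA x hx b (by simp)).symm, (hfB x hx b (by simp)).symm]
  · exact fun x hx y hy hxy => hfA x hx y (by simp [hy, hxy.symm])
  · exact fun x hx y hy hxy => hfB x hx y (by simp [hy, hxy.symm])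
  · intro x hx y hy
    have hyS : y ∈ S := hs.mem_iff.2 (by rw [mem_union] at hy; exact hy)
    simp only [mem_insert, mem_singleton] at hx
    rcases hx with rfl | rfl
    exacts [h.not_adj hyS, h.symm.not_adj hyS]
  · intro x
    have h1 := h.cover x
    rw [hs.mem_iff] at h1
    tauto

theorem exceptional (hc : ¬ Cov G univ ∅ 2) :
    Nonempty (G ≃g LightIndep.F5) ∨ LightIndep.IsInH G (Fintype.card V) := by
  have h2 := h.two_le_card
  obtain h2 | h3 : #S = 2 ∨ 3 ≤ #S := by omega
  · exact Or.inl (h.iso_F5 h2)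
  right
  -- In a disconnection A, B of S the degrees would be at most |A| and |B|, whose sum |S| is one too
  -- small.
  have hconn : Conn G S := by
    rintro A B ⟨s, hs⟩ ⟨t, ht⟩ hd hS hanti
    have hA : A ⊆ S := hS ▸ subset_union_left
    have hB : B ⊆ S := hS ▸ subset_union_right
    have h1 := h.le_of_not_adj (hA hs) (hB ht) (fun e => disjoint_left.1 hd hs (e ▸ ht))
      (hanti s hs t ht)
    have hle : ∀ A B, A ∪ B = S → Anti G A B → ∀ s ∈ A, dIn G univ s ≤ #A := by
      intro A B hS hanti s hs
      have e1 := dIn_univ_le (u := s) (A := insert z (A.erase s)) fun x hx => by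
        have e2 := h.nbr_rest (hS ▸ mem_union_left _ hs) hx
        have e3 := hx.ne'
        have e4 : x ∉ B := fun hb => hanti s hs x hb hx
        simp only [← hS, mem_insert, mem_union, mem_erase] at e2 ⊢
        tauto
      have e2 := card_insert_le z (A.erase s)
      have e3 := card_erase_add_one hs
      omega
    have h4 := hle A B hS hanti s hs
    have h5 := hle B A (by rw [union_comm, hS]) hanti.symm t ht
    have h6 := card_union_of_disjoint hd
    rw [hS] at h6
    omega
  obtain ⟨b, A, B, hs, hA, hB⟩ := exists_split hconn h3 (h.not_twoConn hc)
  rcases le_total #A #B with hAB | hAB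
  exacts [h.isInH hs hA hB hAB, h.isInH hs.symm hB hA hAB]

end PendantEdge

end EdgeBranch

end TwoProper

theorem theorem1p8 {V : Type*} [Fintype V] [DecidableEq V] (G : SimpleGraph V)
    [DecidableRel G.Adj] (n : ℕ) (hn : Fintype.card V = n)
    (hσ : (n : ℕ∞) ≤ LightIndep.sigmaStar G) :
    (∃ P : Finpartition (Finset.univ : Finset V),
        LightIndep.IsKProper G 2 P ∧ P.parts.card ≤ LightIndep.alphaStar G) ∨
      Nonempty (G ≃g (⊤ : SimpleGraph (Fin 2))) ∨
      Nonempty (G ≃g LightIndep.F5) ∨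
      LightIndep.IsInF11 G ∨
      LightIndep.IsInF12 G ∨
      LightIndep.IsInH G n := by
  subst hn
  by_cases hc : TwoProper.Cov G univ ∅ (LightIndep.alphaStar G)
  · exact Or.inl hc.exists_finpartition
  right
  have hheavy := TwoProper.largeHeavy_of_le_sigmaStar hσ
  have hne : Nonempty V := by
    obtain ⟨v, -, -⟩ := TwoProper.exists_mem_of_not_cov hc
    exact ⟨v⟩
  rcases TwoProper.sharpOut_of_not_cov _ _ _ le_rfl hc with h | ⟨-, h⟩ | ⟨h2, h⟩ | ⟨h3, h⟩
  · exact absurd h (TwoProper.not_good_univ hheavy)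
  · obtain ⟨u, u', hadj, he⟩ := h
    refine Or.inl (TwoProper.nonempty_iso_top_two hadj (fun x => ?_) ?_)
    · have := mem_univ x
      rwa [he, mem_insert, mem_singleton] at this
    · rw [← card_univ, he, card_pair hadj.ne]
  · obtain ⟨z, u, u', S, h⟩ := TwoProper.PendantEdge.exists_of_edgeBranch hheavy h
    rcases h.exceptional fun hc' => hc (hc'.mono h2) with h | h
    · exact Or.inr (Or.inl h)
    · exact Or.inr (Or.inr (Or.inr (Or.inr h)))
  · rcases h.exceptional hheavy fun hc' => hc (hc'.mono h3) with h | h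
    · exact Or.inr (Or.inr (Or.inl h))
    · exact Or.inr (Or.inr (Or.inr (Or.inl h)))
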